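/- Let $K$ be an algebraically closed field of characteristic $0$. For a finite-dimensional Lie algebra $\mathfrak g$ over $K$, its index is $\operatorname{ind}\mathfrak g=\min_{f\in\mathfrak g^*}\dim\ker B_f$, where $B_f(x,y)=f([x,y])$. For compositions $\boldsymbol a=(a_1,\dots,a_m)$ and $\boldsymbol b=(b_1,\dots,b_t)$ of $n$, the seaweed subalgebra of type $\boldsymbol a/\boldsymbol b$ is the Lie subalgebra of $\mathfrak{sl}(n)$ of all traceless $n\times n$ matrices over $K$ that preserve each of the subspaces $V_i=\operatorname{span}\{e_1,\dots,e_{a_1+\cdots+a_i}\}$ $(0\le i\le m)$ and $W_j=\operatorname{span}\{e_{b_1+\cdots+b_j+1},\dots,e_n\}$ $(0\le j\le t)$ of $K^n$. Let $C(n,k)$ be the number of ordered pairs $(\boldsymbol a,\boldsymbol b)$ of compositions of $n$ for which the seaweed subalgebra of type $\boldsymbol a/\boldsymbol b$ has index $k$. Then for every integer $n\ge 4$, $$\begin{aligned} C(n,n-3)={}&4\sum_{m=4}^{n-2}\sum_{i=1}^{n-m-1}2^{n-m-2}+8\sum_{m=4}^{n-1}2^{n-m-1}+4\sum_{m=4}^{n-3}\sum_{i=1}^{n-m-2}\sum_{j=1}^{n-m-i-1}2^{n-m-3}(m-3)\\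 &+12\sum_{m=4}^{n-2}\sum_{i=1}^{n-m-1}2^{n-m-2}(m-3)+12\sum_{m=4}^{n-1}2^{n-m-1}(m-3)+4(n-3)+2\sum_{i=1}^{n-5}2^{n-6}+2^{n-3}\\ &+2\sum_{m=3}^{n-2}\sum_{i=1}^{n-m-1}2^{n-m-2}(m-2)+4\sum_{m=3}^{n-1}2^{n-m-1}(m-2)+2(n-2)+4\sum_{i=1}^{n-4}2^{n-5}+2^{n-1}+4, \end{aligned}$$ where a sum whose upper limit is smaller than its lower limit is $0$. -/

import Mathlib

open Matrix

section LieIndex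

variable (K L : Type*) [Field K] [LieRing L] [LieAlgebra K L]

/-- The Kirillov form `B_f(x, y) = f([x, y])` of a linear form `f` on a Lie algebra `L`. -/
def kirillovForm (f : Module.Dual K L) : L →ₗ[K] L →ₗ[K] K :=
  LinearMap.mk₂ K (fun x y => f ⁅x, y⁆)
    (fun x x' y => by rw [add_lie, map_add])
    (fun c x y => by rw [smul_lie, map_smul])
    (fun x y y' => by rw [lie_add, map_add])
    (fun c x y => by rw [lie_smul, map_smul])

/-- The index of a (finite dimensional) Lie algebra `L`: the minimum of `dim (ker B_f)` over all
linear forms `f` on `L`. The infimum is over a nonempty set of natural numbers, so it is a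
minimum. -/
noncomputable def lieIndex : ℕ :=
  ⨅ f : Module.Dual K L, Module.finrank K (LinearMap.ker (kirillovForm K L f))

end LieIndex

section Seaweed

variable (K : Type*) [Field K] {n : ℕ}

/-- For a composition `a = (a_1, …, a_m)` of `n`, the subspace
`V_i = span {e_1, …, e_{a_1 + ⋯ + a_i}}` of `K^n`. The coordinates are numbered from `0` here, so
`e_1, …, e_s` are the basis vectors with number less than `s`. -/
def flagV (a : Composition n) (i : ℕ) : Submodule K (Fin n → K) :=
  Submodule.span K {v | ∃ r : Fin n, (r : ℕ) < a.sizeUpTo i ∧ v = Pi.single r 1}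

/-- For a composition `b = (b_1, …, b_t)` of `n`, the subspace
`W_j = span {e_{b_1 + ⋯ + b_j + 1}, …, e_n}` of `K^n`. -/
def flagW (b : Composition n) (j : ℕ) : Submodule K (Fin n → K) :=
  Submodule.span K {v | ∃ r : Fin n, b.sizeUpTo j ≤ (r : ℕ) ∧ v = Pi.single r 1}

/-- The seaweed subalgebra of `sl(n)` of type `a / b`: the traceless matrices that preserve every
`V_i`, `0 ≤ i ≤ m`, and every `W_j`, `0 ≤ j ≤ t`. -/
def seaweed (a b : Composition n) :
    LieSubalgebra K (LieAlgebra.SpecialLinear.sl (Fin n) K) where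
  carrier := {x |
    (∀ i ≤ a.length, ∀ v ∈ flagV K a i, (x : Matrix (Fin n) (Fin n) K) *ᵥ v ∈ flagV K a i) ∧
    (∀ j ≤ b.length, ∀ v ∈ flagW K b j, (x : Matrix (Fin n) (Fin n) K) *ᵥ v ∈ flagW K b j)}
  zero_mem' := by
    constructor <;> intro i _ v _ <;> simp
  add_mem' := by
    rintro x y ⟨hx, hx'⟩ ⟨hy, hy'⟩
    constructor
    · intro i hi v hv
      simpa [Matrix.add_mulVec] using add_mem (hx i hi v hv) (hy i hi v hv)
    · intro j hj v hv
      simpa [Matrix.add_mulVec] using add_mem (hx' j hj v hv) (hy' j hj v hv)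
  smul_mem' := by
    rintro c x ⟨hx, hx'⟩
    constructor
    · intro i hi v hv
      simpa [Matrix.smul_mulVec] using Submodule.smul_mem _ c (hx i hi v hv)
    · intro j hj v hv
      simpa [Matrix.smul_mulVec] using Submodule.smul_mem _ c (hx' j hj v hv)
  lie_mem' := by
    rintro x y ⟨hx, hx'⟩ ⟨hy, hy'⟩
    constructor
    · intro i hi v hv
      simpa [Ring.lie_def, Matrix.sub_mulVec, Matrix.mulVec_mulVec] using
        sub_mem (hx i hi _ (hy i hi v hv)) (hy i hi _ (hx i hi v hv))
    · intro j hj v hv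
      simpa [Ring.lie_def, Matrix.sub_mulVec, Matrix.mulVec_mulVec] using
        sub_mem (hx' j hj _ (hy' j hj v hv)) (hy' j hj _ (hx' j hj v hv))

/-- `C(n, k)`: the number of ordered pairs `(a, b)` of compositions of `n` for which the seaweed
subalgebra of `sl(n)` of type `a / b` has index `k`. -/
noncomputable def seaweedCount (n k : ℕ) : ℕ :=
  Nat.card {p : Composition n × Composition n // lieIndex K (seaweed K p.1 p.2) = k}

end Seaweed

/-!
The index of a seaweed subalgebra is computed by reducing it to smaller ones, and the pairs `(a, b)`
of index `n - 3` are then counted by following the reductions backwards.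

It is convenient to work in `𝔤𝔩(n)`, where the index is larger by one, and with the subalgebras of
matrices supported on a preorder (`patternIndex`); the seaweed algebra of type `a / b` is the pattern
algebra of `seaweedRel a b`. Let `k` and `l` be the first parts of `a` and `b`, and suppose `k < l`.
The matrices with rows in the first `k` positions and columns in the following `l - k` form an
abelian ideal. A generic linear form on this ideal lies in one orbit, that of a `0/1` matching, and
the Kirillov form at such a linear form has the same nullity as a Kirillov form of its stabilizer,
which is again a seaweed algebra. This gives
* `ind (k, a / l, b) = ind (a / l - 2 k, k, b)` if `2 k ≤ l`
  (`seaweedIndex_cons_cons_of_two_mul_le`),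
* `ind (k, a / l, b) = ind (2 k - l, a / k, b)` if `k ≤ l ≤ 2 k`
  (`seaweedIndex_cons_cons_of_le_two_mul`),
* `ind (k, a / k, b) = k + ind (a / b)` (`seaweedIndex_cons_cons_self`).

At the matching these are explicit linear isomorphisms between kernels. For the generic form one
conjugates by an invertible element of the algebra, and the remaining forms are covered by the
semicontinuity of the nullity (`le_patternIndex_of_generic`).

Write the index as `n - d`. The reductions show that `d = 0` only for `a = b`, and that
`d ≥ min k l` if `k ≠ l`. So for `d ≤ 2` and `k < l` only `k ≤ 2` is possible, and each
reduction leads to a pair with a smaller `d`. This yields recursions for the numbers of pairs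
with `d = 1` and `d = 2` (`defectCount_one_succ`, `defectCount_two_add_two`), with the solution
`(2 s² + 31 s + 80) 2 ^ s` for `d = 2` and `n = s + 5`, which is compared with the closed form of
the sums.
-/

/-! ### Pattern algebras and their index -/

section Pattern

variable {K : Type*} [Field K] {ι ι' : Type*} [Fintype ι] [Fintype ι']

/-- The space of matrices supported on the relation `R`. If `R` is a preorder, it is a subalgebra
of the matrix algebra. -/
def patternSpace (K : Type*) [Field K] {ι : Type*} (R : ι → ι → Prop) :
    Submodule K (Matrix ι ι K) where
  carrier := {x | ∀ i j, ¬ R i j → x i j = 0}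
  zero_mem' := fun _ _ _ => rfl
  add_mem' := fun hx hy i j h => by rw [Matrix.add_apply, hx i j h, hy i j h, add_zero]
  smul_mem' := fun c x hx i j h => by rw [Matrix.smul_apply, hx i j h, smul_zero]

/-- The kernel of the Kirillov form, on the pattern algebra of the preorder `R`, of the linear form
`x ↦ tr (F x)`. Since `tr (F (x y - y x)) = tr ((F x - x F) y)`, it consists of the `x` in the
algebra for which `F x - x F` vanishes at all positions transposed to those of `R`. -/
def patternKer (R : ι → ι → Prop) (F : Matrix ι ι K) : Submodule K (Matrix ι ι K) where
  carrier := {x | (∀ i j, ¬ R i j → x i j = 0) ∧ ∀ i j, R i j → (F * x - x * F) j i = 0}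
  zero_mem' := by simp
  add_mem' := by
    rintro x y ⟨hx, hx'⟩ ⟨hy, hy'⟩
    refine ⟨fun i j h => by rw [Matrix.add_apply, hx i j h, hy i j h, add_zero], fun i j h => ?_⟩
    have : F * (x + y) - (x + y) * F = (F * x - x * F) + (F * y - y * F) := by
      rw [mul_add, add_mul]; abel
    rw [this, Matrix.add_apply, hx' i j h, hy' i j h, add_zero]
  smul_mem' := by
    rintro c x ⟨hx, hx'⟩
    refine ⟨fun i j h => by rw [Matrix.smul_apply, hx i j h, smul_zero], fun i j h => ?_⟩
    have : F * (c • x) - (c • x) * F = c • (F * x - x * F) := by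
      rw [Matrix.mul_smul, Matrix.smul_mul, smul_sub]
    rw [this, Matrix.smul_apply, hx' i j h, smul_zero]

theorem mem_patternKer {R : ι → ι → Prop} {F x : Matrix ι ι K} :
    x ∈ patternKer R F ↔
      (∀ i j, ¬ R i j → x i j = 0) ∧ ∀ i j, R i j → (F * x - x * F) j i = 0 := Iff.rfl

/-- The index of the pattern algebra of `R` as a Lie algebra (for `R` a preorder). -/
noncomputable def patternIndex (K : Type*) [Field K] (R : ι → ι → Prop) : ℕ :=
  ⨅ F : Matrix ι ι K, Module.finrank K (patternKer R F)

theorem patternIndex_le (R : ι → ι → Prop) (F : Matrix ι ι K) :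
    patternIndex K R ≤ Module.finrank K (patternKer R F) :=
  ciInf_le (OrderBot.bddBelow _) F

theorem exists_patternIndex_eq (K : Type*) [Field K] (R : ι → ι → Prop) :
    ∃ F : Matrix ι ι K, Module.finrank K (patternKer R F) = patternIndex K R :=
  ciInf_mem (fun F : Matrix ι ι K => Module.finrank K (patternKer R F))

theorem le_patternIndex {R : ι → ι → Prop} {k : ℕ}
    (h : ∀ F : Matrix ι ι K, k ≤ Module.finrank K (patternKer R F)) : k ≤ patternIndex K R :=
  le_ciInf h

/-- Only the entries of `F` at positions transposed to those of `R` matter. -/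
theorem patternKer_congr {R : ι → ι → Prop} (hR : ∀ i j k, R i j → R j k → R i k)
    {F F' : Matrix ι ι K} (h : ∀ i j, R i j → F j i = F' j i) :
    patternKer R F = patternKer R F' := by
  ext x
  rw [mem_patternKer, mem_patternKer]
  refine and_congr_right fun hx => forall₂_congr fun i j => forall_congr' fun hij => ?_
  have h1 : (F * x) j i = (F' * x) j i := by
    rw [Matrix.mul_apply, Matrix.mul_apply]
    refine Finset.sum_congr rfl fun p _ => ?_
    by_cases hp : R p i
    · rw [h p j (hR _ _ _ hp hij)]
    · rw [hx p i hp, mul_zero, mul_zero]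
  have h2 : (x * F) j i = (x * F') j i := by
    rw [Matrix.mul_apply, Matrix.mul_apply]
    refine Finset.sum_congr rfl fun p _ => ?_
    by_cases hp : R j p
    · rw [h i p (hR _ _ _ hij hp)]
    · rw [hx j p hp, zero_mul, zero_mul]
  rw [Matrix.sub_apply, Matrix.sub_apply, h1, h2]

theorem mul_mul_mem_patternSpace {R : ι → ι → Prop} (hR : ∀ i j k, R i j → R j k → R i k)
    {h x h' : Matrix ι ι K} (hh : h ∈ patternSpace K R) (hx : x ∈ patternSpace K R)
    (hh' : h' ∈ patternSpace K R) : h * x * h' ∈ patternSpace K R := by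
  intro i j hij
  rw [Matrix.mul_apply]
  refine Finset.sum_eq_zero fun q _ => ?_
  by_cases hq : R q j
  · rw [Matrix.mul_apply, Finset.sum_eq_zero, zero_mul]
    intro p _
    by_cases hp : R p q
    · rw [hh i p fun hip => hij (hR _ _ _ hip (hR _ _ _ hp hq)), zero_mul]
    · rw [hx p q hp, mul_zero]
  · rw [hh' q j hq, mul_zero]

theorem mul_mul_apply_eq_zero {R : ι → ι → Prop} (hR : ∀ i j k, R i j → R j k → R i k)
    {h z h' : Matrix ι ι K} (hh : h ∈ patternSpace K R) (hz : ∀ i j, R i j → z j i = 0)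
    (hh' : h' ∈ patternSpace K R) (i j : ι) (hij : R i j) : (h * z * h') j i = 0 := by
  rw [Matrix.mul_apply]
  refine Finset.sum_eq_zero fun q _ => ?_
  by_cases hq : R q i
  · rw [Matrix.mul_apply, Finset.sum_eq_zero, zero_mul]
    intro p _
    by_cases hp : R j p
    · rw [hz q p (hR _ _ _ hq (hR _ _ _ hij hp)), mul_zero]
    · rw [hh j p hp, zero_mul]
  · rw [hh' q i hq, mul_zero]

/-- Conjugating the linear form by an invertible element of the pattern algebra does not change the
dimension of the kernel. -/
theorem finrank_patternKer_conj [DecidableEq ι] {R : ι → ι → Prop}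
    (hR : ∀ i j k, R i j → R j k → R i k)
    {h h' : Matrix ι ι K} (hh : h ∈ patternSpace K R) (hh' : h' ∈ patternSpace K R)
    (h1 : h * h' = 1) (F : Matrix ι ι K) :
    Module.finrank K (patternKer R (h * F * h')) = Module.finrank K (patternKer R F) := by
  have h2 : h' * h = 1 := mul_eq_one_comm.mp h1
  have key : ∀ (g g' F x : Matrix ι ι K), g ∈ patternSpace K R → g' ∈ patternSpace K R →
      g' * g = 1 → x ∈ patternKer R F → g * x * g' ∈ patternKer R (g * F * g') := by
    intro g g' F x hg hg' h1 hx
    refine ⟨mul_mul_mem_patternSpace hR hg hx.1 hg', fun i j hij => ?_⟩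
    have : g * F * g' * (g * x * g') - g * x * g' * (g * F * g') = g * (F * x - x * F) * g' := by
      have e1 : g * F * g' * (g * x * g') = g * F * (g' * g) * x * g' := by
        simp only [Matrix.mul_assoc]
      have e2 : g * x * g' * (g * F * g') = g * x * (g' * g) * F * g' := by
        simp only [Matrix.mul_assoc]
      rw [e1, e2, h1, Matrix.mul_one, Matrix.mul_one, mul_sub, sub_mul]
      simp only [Matrix.mul_assoc]
    rw [this]
    exact mul_mul_apply_eq_zero hR hg hx.2 hg' i j hij
  symm
  refine LinearEquiv.finrank_eq (LinearEquiv.ofBijective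
    (LinearMap.restrict (p := patternKer R F) (q := patternKer R (h * F * h'))
      (LinearMap.mulRight K h' ∘ₗ LinearMap.mulLeft K h)
      fun x hx => key h h' F x hh hh' h2 hx) ⟨?_, ?_⟩)
  · rintro ⟨x, hx⟩ ⟨y, hy⟩ hxy
    have : h * x * h' = h * y * h' := congrArg Subtype.val hxy
    have : h' * (h * x * h') * h = h' * (h * y * h') * h := by rw [this]
    have e : ∀ x : Matrix ι ι K, h' * (h * x * h') * h = (h' * h) * x * (h' * h) := fun x => by
      simp only [Matrix.mul_assoc]
    rw [e, e, h2, Matrix.one_mul, Matrix.one_mul, Matrix.mul_one, Matrix.mul_one] at this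
    exact Subtype.ext this
  · rintro ⟨y, hy⟩
    have e : ∀ x : Matrix ι ι K, h' * (h * x * h') * h = (h' * h) * x * (h' * h) := fun x => by
      simp only [Matrix.mul_assoc]
    have e' : ∀ x : Matrix ι ι K, h * (h' * x * h) * h' = (h * h') * x * (h * h') := fun x => by
      simp only [Matrix.mul_assoc]
    have hy' := key h' h _ y hh' hh h1 hy
    rw [e, h2, Matrix.one_mul, Matrix.mul_one] at hy'
    refine ⟨⟨h' * y * h, hy'⟩, Subtype.ext ?_⟩
    change h * (h' * y * h) * h' = y
    rw [e', h1, Matrix.one_mul, Matrix.mul_one]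

/-- The transpose exchanges a pattern algebra with that of the opposite relation. -/
theorem patternIndex_swap (R : ι → ι → Prop) :
    patternIndex K (fun i j => R j i) = patternIndex K R := by
  have key : ∀ (R : ι → ι → Prop) (F : Matrix ι ι K), Module.finrank K (patternKer R F) =
      Module.finrank K (patternKer (fun i j => R j i) Fᵀ) := by
    intro R F
    have h : (patternKer R F).map (Matrix.transposeLinearEquiv ι ι K K).toLinearMap =
        patternKer (fun i j => R j i) Fᵀ := by
      ext x
      have hx : Fᵀ * x - x * Fᵀ = -(F * xᵀ - xᵀ * F)ᵀ := by
        simp [Matrix.transpose_mul]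
      rw [Submodule.mem_map_equiv, mem_patternKer, mem_patternKer, hx]
      change ((∀ i j, ¬ R i j → x j i = 0) ∧ ∀ i j, R i j → (F * xᵀ - xᵀ * F) j i = 0) ↔ _
      simp only [Matrix.neg_apply, Matrix.transpose_apply, neg_eq_zero]
      exact and_congr forall_comm forall_comm
    rw [← h]
    exact (LinearEquiv.finrank_map_eq _ _).symm
  apply le_antisymm
  · refine le_patternIndex fun F => ?_
    rw [key]
    exact patternIndex_le _ _
  · refine le_patternIndex fun F => ?_
    rw [key]
    exact patternIndex_le _ _

theorem patternIndex_congr {R : ι → ι → Prop} {R' : ι' → ι' → Prop} (e : ι ≃ ι')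
    (h : ∀ i j, R i j ↔ R' (e i) (e j)) : patternIndex K R = patternIndex K R' := by
  have key : ∀ F : Matrix ι ι K, Module.finrank K (patternKer R F) =
      Module.finrank K (patternKer R' (Matrix.reindex e e F)) := by
    intro F
    have hm : (patternKer R F).map (Matrix.reindexLinearEquiv K K e e).toLinearMap =
        patternKer R' (Matrix.reindex e e F) := by
      ext x
      rw [Submodule.mem_map_equiv, mem_patternKer, mem_patternKer]
      have hx : Matrix.reindex e e F * x - x * Matrix.reindex e e F =
          Matrix.reindex e e (F * (x.submatrix e e) - x.submatrix e e * F) := by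
        ext i j
        simp only [Matrix.sub_apply, Matrix.mul_apply, Matrix.reindex_apply,
          Matrix.submatrix_apply]
        rw [← Equiv.sum_comp e, ← Equiv.sum_comp e]
        simp
      rw [hx]
      change ((∀ i j, ¬ R i j → x (e i) (e j) = 0) ∧ ∀ i j, R i j →
        (F * (x.submatrix e e) - x.submatrix e e * F) j i = 0) ↔ _
      simp only [h, e.surjective.forall, Matrix.reindex_apply, Matrix.submatrix_apply,
        Equiv.symm_apply_apply]
    rw [← hm]
    exact (LinearEquiv.finrank_map_eq _ _).symm
  apply le_antisymm
  · refine le_patternIndex fun F => ?_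
    obtain ⟨F, rfl⟩ := (Matrix.reindex e e).surjective F
    rw [← key]
    exact patternIndex_le _ _
  · refine le_patternIndex fun F => ?_
    rw [key]
    exact patternIndex_le _ _

end Pattern

/-! ### Semicontinuity -/

section Semicontinuity

variable {K : Type*} [Field K] {ι : Type*} [Fintype ι]

theorem exists_polynomial_eval_eq_det [DecidableEq ι] (A B : Matrix ι ι K) :
    ∃ p : Polynomial K, ∀ t, p.eval t = (A + t • B).det := by
  refine ⟨(A.map Polynomial.C + (Polynomial.X : Polynomial K) • B.map Polynomial.C).det,
    fun t => ?_⟩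
  rw [← Polynomial.coe_evalRingHom, RingHom.map_det]
  congr 1
  ext i j
  simp [mul_comm t]

/-- The dimension of the kernel of a linear map does not grow under a small deformation along a
line. -/
theorem exists_polynomial_finrank_ker_le {V W : Type*} [AddCommGroup V] [Module K V]
    [FiniteDimensional K V] [AddCommGroup W] [Module K W] (L M : V →ₗ[K] W) :
    ∃ p : Polynomial K, p ≠ 0 ∧ ∀ t, p.eval t ≠ 0 →
      Module.finrank K (LinearMap.ker (L + t • M)) ≤ Module.finrank K (LinearMap.ker L) := by
  obtain ⟨V', hV'⟩ := Submodule.exists_isCompl (LinearMap.ker L)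
  obtain ⟨P, hP⟩ := (L.domRestrict V').exists_leftInverse_of_injective (by
    rw [LinearMap.ker_eq_bot']
    rintro ⟨v, hv⟩ h
    exact Subtype.ext (Submodule.disjoint_def.mp hV'.disjoint v h hv))
  -- On a complement `V'` of the kernel, `L + t M` is injective as soon as its composition with a
  -- left inverse `P` of `L` is, and this composition is `1 + t N`.
  let b := Module.finBasis K V'
  let N : V' →ₗ[K] V' := P ∘ₗ M.domRestrict V'
  obtain ⟨p, hp⟩ := exists_polynomial_eval_eq_det 1 (LinearMap.toMatrix b b N)
  refine ⟨p, ?_, fun t ht => ?_⟩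
  · rintro rfl
    have := hp 0
    simp at this
  · have hdet : LinearMap.det (1 + t • N) ≠ 0 := by
      rw [← LinearMap.det_toMatrix b, map_add, map_smul, LinearMap.toMatrix_one, ← hp]
      exact ht
    have hinj : ∀ v : V', (1 + t • N) v = 0 → v = 0 := fun v hv => by
      have := (LinearMap.equivOfDetNeZero _ hdet).injective
      apply this
      rw [map_zero]
      exact hv
    have hdisj : Disjoint (LinearMap.ker (L + t • M)) V' := by
      rw [Submodule.disjoint_def]
      intro v hv hvV
      have h0 : P ((L + t • M) v) = 0 := by rw [LinearMap.mem_ker.mp hv, map_zero]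
      have h1 : P (L v) = ⟨v, hvV⟩ := LinearMap.congr_fun hP ⟨v, hvV⟩
      have := hinj ⟨v, hvV⟩ (by
        rw [← h0, LinearMap.add_apply (L : V →ₗ[K] W), map_add, h1]
        simp [N])
      exact congrArg Subtype.val this
    have h1 := Submodule.finrank_add_finrank_le_of_disjoint hdisj
    have h2 := Submodule.finrank_add_eq_of_isCompl hV'
    omega

theorem exists_polynomial_finrank_patternKer_le (R : ι → ι → Prop) (F G : Matrix ι ι K) :
    ∃ p : Polynomial K, p ≠ 0 ∧ ∀ t, p.eval t ≠ 0 →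
      Module.finrank K (patternKer R (F + t • G)) ≤ Module.finrank K (patternKer R F) := by
  let L : Matrix ι ι K → patternSpace K R →ₗ[K] ({p : ι × ι // R p.1 p.2} → K) := fun F =>
    { toFun := fun x p => (F * x.1 - x.1 * F) p.1.2 p.1.1
      map_add' := fun x y => by
        ext p
        simp only [Submodule.coe_add, mul_add, add_mul, Matrix.sub_apply, Matrix.add_apply,
          Pi.add_apply]
        ring
      map_smul' := fun c x => by
        ext p
        simp only [Submodule.coe_smul, Matrix.mul_smul, Matrix.smul_mul, Matrix.sub_apply,
          Matrix.smul_apply, Pi.smul_apply, smul_eq_mul, RingHom.id_apply]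
        ring }
  have hL : ∀ F, Module.finrank K (LinearMap.ker (L F)) =
      Module.finrank K (patternKer R F) := by
    intro F
    have : (LinearMap.ker (L F)).map (patternSpace K R).subtype = patternKer R F := by
      ext x
      constructor
      · rintro ⟨y, hy, rfl⟩
        exact ⟨y.2, fun i j h => congrFun (LinearMap.mem_ker.mp hy) ⟨(i, j), h⟩⟩
      · rintro ⟨h1, h2⟩
        exact ⟨⟨x, h1⟩, LinearMap.mem_ker.mpr (funext fun p => h2 _ _ p.2), rfl⟩
    rw [← this]
    exact (Submodule.finrank_map_subtype_eq _ _).symm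
  obtain ⟨p, hp, h⟩ := exists_polynomial_finrank_ker_le (L F) (L G)
  refine ⟨p, hp, fun t ht => ?_⟩
  rw [← hL, ← hL]
  have : L (F + t • G) = L F + t • L G := by
    ext x p
    simp only [L, LinearMap.coe_mk, AddHom.coe_mk, LinearMap.add_apply, LinearMap.smul_apply,
      add_mul, mul_add, Matrix.mul_smul, Matrix.smul_mul, Matrix.sub_apply,
      Matrix.smul_apply, Matrix.add_apply, Pi.add_apply, Pi.smul_apply, smul_eq_mul]
    ring
  rw [this]
  exact h t ht

/-- A lower bound for the dimension of the kernel holds for every linear form as soon as it holds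
for those at which a given nonzero polynomial function `q` does not vanish. -/
theorem le_patternIndex_of_generic [Infinite K] {R : ι → ι → Prop} {k : ℕ} (q : Matrix ι ι K → K)
    (hq : ∀ F G, ∃ p : Polynomial K, ∀ t, p.eval t = q (F + t • G))
    (F₀ : Matrix ι ι K) (h₀ : q F₀ ≠ 0)
    (h : ∀ F : Matrix ι ι K, q F ≠ 0 → k ≤ Module.finrank K (patternKer R F)) :
    k ≤ patternIndex K R := by
  refine le_patternIndex fun F => ?_
  obtain ⟨p, hp, hpF⟩ := exists_polynomial_finrank_patternKer_le R F (F₀ - F)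
  obtain ⟨p', hp'⟩ := hq F (F₀ - F)
  have hp'0 : p' ≠ 0 := by
    rintro rfl
    have := hp' 1
    rw [one_smul, add_sub_cancel, Polynomial.eval_zero] at this
    exact h₀ this.symm
  obtain ⟨t, ht⟩ : ∃ t, (p * p').eval t ≠ 0 := by
    by_contra! hcon
    exact mul_ne_zero hp hp'0 (Polynomial.funext fun t => by simpa using hcon t)
  rw [Polynomial.eval_mul] at ht
  exact (h _ (by rw [← hp']; exact right_ne_zero_of_mul ht)).trans
    (hpF t (left_ne_zero_of_mul ht))

end Semicontinuity

/-! ### Gluing a full matrix block to a pattern algebra -/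

section Glue

/-- The relation on `A ⊕ C` which is full on `A`, is `R` on `C`, and relates every element of `A` to
the elements of `B ⊆ C`. Its pattern algebra is the extension of `𝔤𝔩(A) ⊕ 𝔤_R` by the abelian ideal
of `A × B` matrices. -/
def glueRel {C : Type*} (A : Type*) (B : C → Prop) (R : C → C → Prop) : A ⊕ C → A ⊕ C → Prop
  | .inl _, .inl _ => True
  | .inl _, .inr c => B c
  | .inr _, .inl _ => False
  | .inr c, .inr c' => R c c'

variable {K : Type*} [Field K] {A C D : Type*} {B : C → Prop} {R : C → C → Prop}

theorem glueRel_trans (hR : ∀ i j k, R i j → R j k → R i k) (hB : ∀ c c', B c → R c c' → B c') :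
    ∀ i j k, glueRel A B R i j → glueRel A B R j k → glueRel A B R i k := by
  rintro (i | i) (j | j) (k | k) <;> simp only [glueRel, imp_self, implies_true, true_implies,
    false_implies]
  · exact hB j k
  · exact hR i j k

theorem fromBlocks_mem_patternSpace {X : Matrix A A K} {v : Matrix A C K} {w : Matrix C A K}
    {y : Matrix C C K} : Matrix.fromBlocks X v w y ∈ patternSpace K (glueRel A B R) ↔
      (∀ a c, ¬ B c → v a c = 0) ∧ w = 0 ∧ y ∈ patternSpace K R := by
  constructor
  · intro h
    refine ⟨fun a c hc => h (.inl a) (.inr c) hc, ?_, fun c c' hc => h (.inr c) (.inr c') hc⟩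
    ext c a
    exact h (.inr c) (.inl a) id
  · rintro ⟨h1, rfl, h3⟩ (i | i) (j | j) hij
    · exact absurd trivial hij
    · exact h1 i j hij
    · rfl
    · exact h3 i j hij

variable [Fintype A] [Fintype C] [Fintype D]

theorem fromBlocks_mem_patternKer {P : Matrix A A K} {ξ : Matrix C A K} {G : Matrix C C K}
    {X : Matrix A A K} {v : Matrix A C K} {w : Matrix C A K} {y : Matrix C C K} :
    Matrix.fromBlocks X v w y ∈ patternKer (glueRel A B R) (Matrix.fromBlocks P 0 ξ G) ↔
      ((∀ a c, ¬ B c → v a c = 0) ∧ w = 0 ∧ y ∈ patternSpace K R) ∧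
      P * X - (X * P + v * ξ) = 0 ∧ (∀ a c, B c → (ξ * X - y * ξ) c a = 0) ∧
      ∀ c c', R c c' → (ξ * v + G * y - y * G) c' c = 0 := by
  rw [← fromBlocks_mem_patternSpace (B := B) (R := R)]
  change _ ∧ _ ↔ _
  refine and_congr_right fun h => ?_
  obtain ⟨-, rfl, -⟩ := fromBlocks_mem_patternSpace.mp h
  simp only [Matrix.fromBlocks_multiply, Matrix.zero_mul, Matrix.mul_zero, add_zero, zero_add]
  constructor
  · intro h
    refine ⟨?_, fun a c hc => ?_, fun c c' hc => ?_⟩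
    · ext a a'
      exact h (.inl a') (.inl a) trivial
    · exact h (.inl a) (.inr c) hc
    · exact h (.inr c) (.inr c') hc
  · rintro ⟨h1, h2, h3⟩ (i | i) (j | j) hij
    · exact congrFun (congrFun h1 j) i
    · exact h2 i j hij
    · exact hij.elim
    · exact h3 i j hij

end Glue

section Matching

variable {K : Type*} [Field K] {C D X : Type*} [DecidableEq C]

/-- The `0/1` matrix with an entry `1` at the positions `(e d, d)`. -/
def matchingMatrix (K : Type*) [Field K] (e : D → C) : Matrix C D K :=
  Matrix.of fun c d => if c = e d then 1 else 0

theorem matchingMatrix_mul_apply [Fintype D] {e : D → C} (he : Function.Injective e)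
    (M : Matrix D X K) (d : D) (x : X) : (matchingMatrix K e * M) (e d) x = M d x := by
  classical
  simp [matchingMatrix, Matrix.mul_apply, he.eq_iff]

theorem matchingMatrix_mul_apply_of_notMem [Fintype D] {e : D → C} (M : Matrix D X K) {c : C}
    (hc : c ∉ Set.range e) (x : X) : (matchingMatrix K e * M) c x = 0 := by
  rw [Matrix.mul_apply]
  refine Finset.sum_eq_zero fun d _ => ?_
  have : c ≠ e d := fun h => hc ⟨d, h.symm⟩
  simp [matchingMatrix, this]

theorem mul_matchingMatrix_transpose_apply_of_notMem [Fintype D] {e : D → C} (M : Matrix X D K)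
    {c : C} (hc : c ∉ Set.range e) (x : X) : (M * (matchingMatrix K e)ᵀ) x c = 0 := by
  have := matchingMatrix_mul_apply_of_notMem (K := K) Mᵀ hc x
  rwa [← Matrix.transpose_apply (matchingMatrix K e * Mᵀ), Matrix.transpose_mul,
    Matrix.transpose_transpose] at this

variable [Fintype C]

theorem mul_matchingMatrix_apply {e : D → C} (M : Matrix X C K) (x : X) (d : D) :
    (M * matchingMatrix K e) x d = M x (e d) := by
  simp [matchingMatrix, Matrix.mul_apply]

theorem matchingMatrix_transpose_mul_apply {e : D → C} (M : Matrix C X K) (d : D) (x : X) :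
    ((matchingMatrix K e)ᵀ * M) d x = M (e d) x := by
  simp [matchingMatrix, Matrix.mul_apply]

theorem matchingMatrix_transpose_mul_self [DecidableEq D] {e : D → C}
    (he : Function.Injective e) : (matchingMatrix K e)ᵀ * matchingMatrix K e = 1 := by
  ext d d'
  rw [mul_matchingMatrix_apply]
  simp [matchingMatrix, Matrix.one_apply, he.eq_iff, eq_comm]

theorem matchingMatrix_transpose_mul_eq_zero {e : D → C} (M : Matrix C X K) :
    (∀ x, ∀ c ∈ Set.range e, M c x = 0) ↔ (matchingMatrix K e)ᵀ * M = 0 := by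
  constructor
  · intro hM
    ext d x
    rw [matchingMatrix_transpose_mul_apply]
    exact hM x _ ⟨d, rfl⟩
  · rintro hM x _ ⟨d, rfl⟩
    have := matchingMatrix_transpose_mul_apply (K := K) (e := e) M d x
    rwa [hM, Matrix.zero_apply, eq_comm] at this

theorem mul_matchingMatrix_mul_transpose [Fintype D] {e : D → C} (he : Function.Injective e)
    (v : Matrix X C K) (hv : ∀ x, ∀ c ∉ Set.range e, v x c = 0) :
    v * matchingMatrix K e * (matchingMatrix K e)ᵀ = v := by
  ext x c
  by_cases hc : c ∈ Set.range e
  · obtain ⟨d, rfl⟩ := hc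
    rw [← Matrix.transpose_apply (v * matchingMatrix K e * (matchingMatrix K e)ᵀ),
      Matrix.transpose_mul, Matrix.transpose_transpose, matchingMatrix_mul_apply he,
      Matrix.transpose_apply, mul_matchingMatrix_apply]
  · rw [mul_matchingMatrix_transpose_apply_of_notMem _ hc, hv x c hc]

end Matching

section Glue

variable {K : Type*} [Field K] {A C D : Type*} [Fintype A] [Fintype C] [Fintype D]
  [DecidableEq C] {B : C → Prop} {R : C → C → Prop}

/-- At a matching `e : A → B`, the equations of the kernel determine the blocks on `A × A` and on
`A × C` from the block on `C × C`, which lies in the kernel for the stabilizer of the matching. -/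
theorem finrank_patternKer_glueRel_of_range_subset {e : A → C} (he : Function.Injective e)
    (heB : ∀ a, B (e a)) (hBe : ∀ c, B c → c ∉ Set.range e → ∀ a, R c (e a)) (G : Matrix C C K) :
    Module.finrank K (patternKer (glueRel A B R)
      (Matrix.fromBlocks 0 0 (matchingMatrix K e) G)) =
    Module.finrank K (patternKer
      (fun c c' => R c c' ∧ ¬ (B c ∧ c ∉ Set.range e ∧ c' ∈ Set.range e)) G) := by
  classical
  set J := matchingMatrix K e with hJ
  set R' : C → C → Prop := fun c c' => R c c' ∧ ¬ (B c ∧ c ∉ Set.range e ∧ c' ∈ Set.range e)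
  let π : Matrix (A ⊕ C) (A ⊕ C) K →ₗ[K] Matrix C C K :=
    { toFun := Matrix.toBlocks₂₂, map_add' := fun _ _ => rfl, map_smul' := fun _ _ => rfl }
  -- all blocks of an element of the kernel are given by its block `y` on `C`
  have hmem : ∀ (X : Matrix A A K) (v : Matrix A C K) (w : Matrix C A K) (y : Matrix C C K),
      Matrix.fromBlocks X v w y ∈ patternKer (glueRel A B R) (Matrix.fromBlocks 0 0 J G) ↔
      w = 0 ∧ y ∈ patternKer R' G ∧ (∀ a a', X a a' = y (e a) (e a')) ∧
      (∀ a c, v a c = if B c ∧ c ∉ Set.range e then (y * G - G * y) (e a) c else 0) := by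
    intro X v w y
    rw [fromBlocks_mem_patternKer, Matrix.zero_mul, Matrix.mul_zero, zero_add, zero_sub,
      neg_eq_zero]
    constructor
    · rintro ⟨⟨h1, h2, h3⟩, h4, h5, h6⟩
      have hv : ∀ a a', v a (e a') = 0 := fun a a' => by
        rw [← mul_matchingMatrix_apply v a a']
        exact congrFun (congrFun h4 a) a'
      refine ⟨h2, ⟨fun c c' hc => ?_, fun c c' hc => ?_⟩, fun a a' => ?_, fun a c => ?_⟩
      · by_cases hR : R c c'
        · by_cases hE : B c ∧ c ∉ Set.range e ∧ c' ∈ Set.range e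
          · obtain ⟨hB, hc1, a, rfl⟩ := hE
            have := h5 a c hB
            rwa [Matrix.sub_apply, hJ, matchingMatrix_mul_apply_of_notMem _ hc1,
              mul_matchingMatrix_apply, zero_sub, neg_eq_zero] at this
          · exact absurd ⟨hR, hE⟩ hc
        · exact h3 c c' hR
      · have := h6 c c' hc.1
        rw [add_sub_assoc, Matrix.add_apply] at this
        by_cases hE : c' ∈ Set.range e
        · obtain ⟨a, rfl⟩ := hE
          have hvc : v a c = 0 := by
            by_cases hB : B c
            · by_cases hce : c ∈ Set.range e
              · obtain ⟨a', rfl⟩ := hce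
                exact hv a a'
              · exact absurd ⟨hB, hce, a, rfl⟩ hc.2
            · exact h1 a c hB
          rwa [hJ, matchingMatrix_mul_apply he, hvc, zero_add] at this
        · rwa [hJ, matchingMatrix_mul_apply_of_notMem _ hE, zero_add] at this
      · have := h5 a' (e a) (heB a)
        rwa [Matrix.sub_apply, hJ, matchingMatrix_mul_apply he, mul_matchingMatrix_apply,
          sub_eq_zero] at this
      · split_ifs with hc
        · have := h6 c (e a) (hBe c hc.1 hc.2 a)
          rw [add_sub_assoc, Matrix.add_apply, hJ, matchingMatrix_mul_apply he,
            add_eq_zero_iff_eq_neg] at this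
          rw [this, ← Matrix.neg_apply, neg_sub]
        · by_cases hB : B c
          · by_cases hce : c ∈ Set.range e
            · obtain ⟨a', rfl⟩ := hce
              exact hv a a'
            · exact absurd ⟨hB, hce⟩ hc
          · exact h1 a c hB
    · rintro ⟨h1, ⟨h2, h3⟩, h4, h5⟩
      refine ⟨⟨fun a c hc => ?_, h1, fun c c' hc => h2 c c' fun h => hc h.1⟩, ?_,
        fun a c hc => ?_, fun c c' hc => ?_⟩
      · rw [h5, if_neg fun h => hc h.1]
      · ext a a'
        rw [hJ, mul_matchingMatrix_apply, h5, if_neg fun h => h.2 ⟨a', rfl⟩, Matrix.zero_apply]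
      · rw [Matrix.sub_apply, hJ, mul_matchingMatrix_apply]
        by_cases hE : c ∈ Set.range e
        · obtain ⟨a', rfl⟩ := hE
          rw [matchingMatrix_mul_apply he, h4, sub_self]
        · rw [matchingMatrix_mul_apply_of_notMem _ hE, zero_sub, neg_eq_zero]
          exact h2 _ _ fun h => h.2 ⟨hc, hE, a, rfl⟩
      · rw [add_sub_assoc, Matrix.add_apply]
        by_cases hE : c' ∈ Set.range e
        · obtain ⟨a, rfl⟩ := hE
          rw [hJ, matchingMatrix_mul_apply he, h5]
          split_ifs with hcB
          · rw [← neg_sub (G * y), Matrix.neg_apply, neg_add_cancel]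
          · rw [zero_add]
            exact h3 _ _ ⟨hc, fun h => hcB ⟨h.1, h.2.1⟩⟩
        · rw [hJ, matchingMatrix_mul_apply_of_notMem _ hE, zero_add]
          exact h3 _ _ ⟨hc, fun h => hE h.2.2⟩
  have hmem' : ∀ x ∈ patternKer (glueRel A B R) (Matrix.fromBlocks 0 0 J G),
      π x ∈ patternKer R' G := by
    intro x hx
    rw [← Matrix.fromBlocks_toBlocks x, hmem] at hx
    exact hx.2.1
  refine LinearEquiv.finrank_eq (LinearEquiv.ofBijective (π.restrict hmem') ⟨?_, ?_⟩)
  · rw [injective_iff_map_eq_zero]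
    rintro ⟨x, hx⟩ h0
    have hy : x.toBlocks₂₂ = 0 := congrArg Subtype.val h0
    rw [← Matrix.fromBlocks_toBlocks x, hmem] at hx
    obtain ⟨h1, -, h2, h3⟩ := hx
    refine Subtype.ext ?_
    change x = 0
    rw [← Matrix.fromBlocks_toBlocks x, hy, h1, ← Matrix.fromBlocks_zero]
    congr 1
    · ext a a'
      rw [h2, hy, Matrix.zero_apply, Matrix.zero_apply]
    · ext a c
      rw [h3, hy, Matrix.zero_mul, Matrix.mul_zero, sub_zero, Matrix.zero_apply, ite_self,
        Matrix.zero_apply]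
  · rintro ⟨y, hy⟩
    exact ⟨⟨Matrix.fromBlocks (y.submatrix e e) (Matrix.of fun a c =>
      if B c ∧ c ∉ Set.range e then (y * G - G * y) (e a) c else 0) 0 y,
      (hmem _ _ _ _).mpr ⟨rfl, hy, fun _ _ => rfl, fun _ _ => rfl⟩⟩, Subtype.ext rfl⟩

/-- At a matching `e : D → B` with image `B`, the equations of the kernel determine the `D × D` block
from that on `B × B`, and force the `D × A` block to vanish; the `A × D` block is transported by
`e` to an `A × B` block. -/
theorem finrank_patternKer_glueRel_of_range_eq [DecidableEq D] {e : D → C} (he : Function.Injective e)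
    (heB : ∀ c, B c ↔ c ∈ Set.range e) (P₀ : Matrix A A K) (P₁ : Matrix D A K)
    (G : Matrix C C K) :
    Module.finrank K (patternKer (glueRel (A ⊕ D) B R)
      (Matrix.fromBlocks (Matrix.fromBlocks P₀ 0 P₁ 0) 0
        (Matrix.fromCols 0 (matchingMatrix K e)) G)) =
    Module.finrank K (patternKer (glueRel A B R)
      (Matrix.fromBlocks P₀ 0 (matchingMatrix K e * P₁) G)) := by
  set J := matchingMatrix K e with hJ
  have hJJ : Jᵀ * J = 1 := matchingMatrix_transpose_mul_self he
  have hmem : ∀ (X₀ : Matrix A A K) (X₁ : Matrix A D K) (X₂ : Matrix D A K) (X₃ : Matrix D D K)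
      (v₀ : Matrix A C K) (v₁ : Matrix D C K) (w : Matrix C (A ⊕ D) K) (y : Matrix C C K),
      Matrix.fromBlocks (Matrix.fromBlocks X₀ X₁ X₂ X₃) (Matrix.fromRows v₀ v₁) w y ∈
        patternKer (glueRel (A ⊕ D) B R) (Matrix.fromBlocks (Matrix.fromBlocks P₀ 0 P₁ 0) 0
          (Matrix.fromCols 0 J) G) ↔
      w = 0 ∧ X₂ = 0 ∧ X₃ = Jᵀ * y * J ∧ v₀ = P₀ * (X₁ * Jᵀ) ∧ v₁ = P₁ * (X₁ * Jᵀ) ∧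
        Matrix.fromBlocks X₀ (X₁ * Jᵀ) 0 y ∈ patternKer (glueRel A B R)
          (Matrix.fromBlocks P₀ 0 (J * P₁) G) := by
    intro X₀ X₁ X₂ X₃ v₀ v₁ w y
    rw [fromBlocks_mem_patternKer, fromBlocks_mem_patternKer]
    simp only [heB, matchingMatrix_transpose_mul_eq_zero]
    have e1 : Matrix.fromBlocks P₀ 0 P₁ 0 * Matrix.fromBlocks X₀ X₁ X₂ X₃ -
        (Matrix.fromBlocks X₀ X₁ X₂ X₃ * Matrix.fromBlocks P₀ 0 P₁ 0 +
          Matrix.fromRows v₀ v₁ * Matrix.fromCols 0 J) = 0 ↔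
        (P₀ * X₀ - (X₀ * P₀ + X₁ * P₁) = 0 ∧ P₀ * X₁ - v₀ * J = 0) ∧
        P₁ * X₀ - (X₂ * P₀ + X₃ * P₁) = 0 ∧ P₁ * X₁ - v₁ * J = 0 := by
      rw [Matrix.fromRows_mul_fromCols, Matrix.fromBlocks_multiply, Matrix.fromBlocks_multiply,
        Matrix.fromBlocks_add, sub_eq_zero, Matrix.fromBlocks_inj]
      simp only [Matrix.mul_zero, Matrix.zero_mul, add_zero, zero_add, sub_eq_zero]
      tauto
    have e2 : Jᵀ * (Matrix.fromCols (0 : Matrix C A K) J * Matrix.fromBlocks X₀ X₁ X₂ X₃ -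
        y * Matrix.fromCols 0 J) = 0 ↔ X₂ = 0 ∧ X₃ = Jᵀ * y * J := by
      have : Matrix.fromCols (0 : Matrix C A K) J * Matrix.fromBlocks X₀ X₁ X₂ X₃ -
          y * Matrix.fromCols 0 J =
          Matrix.fromCols (J * X₂) (J * X₃ - y * J) := by
        rw [Matrix.fromCols_mul_fromBlocks, Matrix.mul_fromCols]
        ext i (j | j) <;> simp
      rw [this, Matrix.mul_fromCols, ← Matrix.fromCols_zero, Matrix.fromCols_ext_iff,
        ← Matrix.mul_assoc, hJJ, Matrix.one_mul, Matrix.mul_sub, ← Matrix.mul_assoc Jᵀ J, hJJ,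
        Matrix.one_mul, sub_eq_zero, ← Matrix.mul_assoc]
    have e3 : Matrix.fromCols (0 : Matrix C A K) J * Matrix.fromRows v₀ v₁ = J * v₁ := by
      rw [Matrix.fromCols_mul_fromRows, Matrix.zero_mul, zero_add]
    have e4 : Jᵀ * (J * P₁ * X₀ - y * (J * P₁)) = P₁ * X₀ - Jᵀ * y * J * P₁ := by
      rw [Matrix.mul_sub, ← Matrix.mul_assoc, ← Matrix.mul_assoc, hJJ, Matrix.one_mul]
      simp only [Matrix.mul_assoc]
    have e5 : X₁ * Jᵀ * (J * P₁) = X₁ * P₁ := by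
      rw [Matrix.mul_assoc, ← Matrix.mul_assoc Jᵀ, hJJ, Matrix.one_mul]
    rw [← hJ, e1, e2, e3, e4, e5]
    constructor
    · rintro ⟨⟨h1, h2, h3⟩, ⟨⟨h4, h5⟩, h6, h7⟩, ⟨h8, h9⟩, h10⟩
      have hv₀ : v₀ = P₀ * (X₁ * Jᵀ) := by
        rw [← Matrix.mul_assoc, sub_eq_zero.mp h5, hJ, mul_matchingMatrix_mul_transpose he]
        exact fun a c hc => h1 (.inl a) c hc
      have hv₁ : v₁ = P₁ * (X₁ * Jᵀ) := by
        rw [← Matrix.mul_assoc, sub_eq_zero.mp h7, hJ, mul_matchingMatrix_mul_transpose he]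
        exact fun a c hc => h1 (.inr a) c hc
      rw [h8, Matrix.zero_mul, zero_add, h9] at h6
      refine ⟨h2, h8, h9, hv₀, hv₁, ⟨fun a c hc =>
        mul_matchingMatrix_transpose_apply_of_notMem _ hc a, trivial, h3⟩, h4, h6, ?_⟩
      rwa [Matrix.mul_assoc J, ← hv₁]
    · rintro ⟨h1, h2, h3, h4, h5, ⟨-, -, h6⟩, h7, h8, h9⟩
      refine ⟨⟨?_, h1, h6⟩, ⟨⟨h7, ?_⟩, ?_, ?_⟩, ⟨h2, h3⟩, ?_⟩
      · rintro (a | a) c hc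
        · rw [Matrix.fromRows_apply_inl, h4, ← Matrix.mul_assoc]
          exact mul_matchingMatrix_transpose_apply_of_notMem _ hc a
        · rw [Matrix.fromRows_apply_inr, h5, ← Matrix.mul_assoc]
          exact mul_matchingMatrix_transpose_apply_of_notMem _ hc a
      · rw [h4, Matrix.mul_assoc, Matrix.mul_assoc, hJJ, Matrix.mul_one, sub_self]
      · rwa [h2, Matrix.zero_mul, zero_add, h3]
      · rw [h5, Matrix.mul_assoc, Matrix.mul_assoc, hJJ, Matrix.mul_one, sub_self]
      · rwa [h5, ← Matrix.mul_assoc J]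
  have hx : ∀ x : Matrix ((A ⊕ D) ⊕ C) ((A ⊕ D) ⊕ C) K, x = Matrix.fromBlocks
      (Matrix.fromBlocks x.toBlocks₁₁.toBlocks₁₁ x.toBlocks₁₁.toBlocks₁₂ x.toBlocks₁₁.toBlocks₂₁
        x.toBlocks₁₁.toBlocks₂₂) (Matrix.fromRows x.toBlocks₁₂.toRows₁ x.toBlocks₁₂.toRows₂)
        x.toBlocks₂₁ x.toBlocks₂₂ := fun x => by
    rw [Matrix.fromBlocks_toBlocks, Matrix.fromRows_toRows, Matrix.fromBlocks_toBlocks]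
  let π : Matrix ((A ⊕ D) ⊕ C) ((A ⊕ D) ⊕ C) K →ₗ[K] Matrix (A ⊕ C) (A ⊕ C) K :=
    { toFun := fun x => Matrix.fromBlocks x.toBlocks₁₁.toBlocks₁₁ (x.toBlocks₁₁.toBlocks₁₂ * Jᵀ) 0
        x.toBlocks₂₂
      map_add' := fun x y => by
        rw [Matrix.fromBlocks_add, ← Matrix.add_mul, add_zero]
        rfl
      map_smul' := fun c x => by
        rw [RingHom.id_apply, Matrix.fromBlocks_smul, ← Matrix.smul_mul, smul_zero]
        rfl }
  have hmem' : ∀ x ∈ patternKer (glueRel (A ⊕ D) B R) (Matrix.fromBlocks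
      (Matrix.fromBlocks P₀ 0 P₁ 0) 0 (Matrix.fromCols 0 J) G),
      π x ∈ patternKer (glueRel A B R) (Matrix.fromBlocks P₀ 0 (J * P₁) G) := by
    intro x h
    rw [hx x, hmem] at h
    exact h.2.2.2.2.2
  refine LinearEquiv.finrank_eq (LinearEquiv.ofBijective (π.restrict hmem') ⟨?_, ?_⟩)
  · rw [injective_iff_map_eq_zero]
    rintro ⟨x, h⟩ h0
    have h0' : Matrix.fromBlocks x.toBlocks₁₁.toBlocks₁₁ (x.toBlocks₁₁.toBlocks₁₂ * Jᵀ) 0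
        x.toBlocks₂₂ = 0 := congrArg Subtype.val h0
    rw [← Matrix.fromBlocks_zero, Matrix.fromBlocks_inj] at h0'
    obtain ⟨k1, k2, -, k3⟩ := h0'
    have k2' : x.toBlocks₁₁.toBlocks₁₂ = 0 := by
      rw [← Matrix.mul_one (x.toBlocks₁₁.toBlocks₁₂), ← hJJ, ← Matrix.mul_assoc, k2,
        Matrix.zero_mul]
    rw [hx x, hmem] at h
    obtain ⟨h1, h2, h3, h4, h5, -⟩ := h
    refine Subtype.ext ?_
    change x = 0
    rw [hx x, h1, h2, h3, h4, h5, k1, k2', k3]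
    simp
  · rintro ⟨z, hz⟩
    have hz1 := hz.1
    rw [← Matrix.fromBlocks_toBlocks z] at hz hz1
    obtain ⟨h1, h2, -⟩ := fromBlocks_mem_patternSpace.mp hz1
    set u := z.toBlocks₁₂ with hu
    have hvJ : u * J * Jᵀ = u := mul_matchingMatrix_mul_transpose he u fun a c hc =>
      h1 a c (by rwa [heB])
    refine ⟨⟨Matrix.fromBlocks (Matrix.fromBlocks z.toBlocks₁₁ (u * J) 0 (Jᵀ * z.toBlocks₂₂ * J))
      (Matrix.fromRows (P₀ * (u * J * Jᵀ)) (P₁ * (u * J * Jᵀ))) 0 z.toBlocks₂₂,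
      (hmem _ _ _ _ _ _ _ _).mpr ⟨rfl, rfl, rfl, rfl, rfl, ?_⟩⟩, Subtype.ext ?_⟩
    · rw [hvJ]
      rwa [h2] at hz
    · change Matrix.fromBlocks z.toBlocks₁₁ (u * J * Jᵀ) 0 z.toBlocks₂₂ = z
      rw [hvJ, ← h2, hu, Matrix.fromBlocks_toBlocks]

end Glue

/-! ### The index of a glued pattern algebra -/

section GlueIndex

variable {K : Type*} [Field K] {A C D : Type*} [Fintype A] [Fintype C] [Fintype D]
  {B : C → Prop} {R : C → C → Prop}

/-- The block of `F` on `A × C`, and its rows on `C × A` outside `B`, do not matter. -/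
theorem finrank_patternKer_fromBlocks_congr
    (hR : ∀ i j k, R i j → R j k → R i k) (hB : ∀ c c', B c → R c c' → B c')
    (P : Matrix A A K) (Q Q' : Matrix A C K) {ξ ξ' : Matrix C A K} (G : Matrix C C K)
    (hξ : ∀ c, B c → ∀ a, ξ c a = ξ' c a) :
    Module.finrank K (patternKer (glueRel A B R) (Matrix.fromBlocks P Q ξ G)) =
    Module.finrank K (patternKer (glueRel A B R) (Matrix.fromBlocks P Q' ξ' G)) := by
  rw [patternKer_congr (glueRel_trans hR hB)]
  rintro (i | i) (j | j) hij
  · rfl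
  · exact hξ j hij i
  · exact hij.elim
  · rfl

variable [DecidableEq A] [DecidableEq C] [DecidableEq D]

/-- Conjugation by the block `M` on `A`. -/
theorem finrank_patternKer_conj_block (hR : ∀ i j k, R i j → R j k → R i k)
    (hR' : ∀ i, R i i) (hB : ∀ c c', B c → R c c' → B c')
    {M M' : Matrix A A K} (hM : M * M' = 1) (P : Matrix A A K) (ξ : Matrix C A K)
    (G : Matrix C C K) :
    Module.finrank K (patternKer (glueRel A B R) (Matrix.fromBlocks (M * P * M') 0 (ξ * M') G)) =
    Module.finrank K (patternKer (glueRel A B R) (Matrix.fromBlocks P 0 ξ G)) := by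
  have h1 : (1 : Matrix C C K) ∈ patternSpace K R := fun i j hij =>
    Matrix.one_apply_ne fun h => hij (h ▸ hR' i)
  have h := finrank_patternKer_conj (K := K) (glueRel_trans (A := A) hR hB)
    (h := Matrix.fromBlocks M 0 0 1) (h' := Matrix.fromBlocks M' 0 0 1)
    (fromBlocks_mem_patternSpace.mpr ⟨fun _ _ _ => rfl, rfl, h1⟩)
    (fromBlocks_mem_patternSpace.mpr ⟨fun _ _ _ => rfl, rfl, h1⟩)
    (by rw [Matrix.fromBlocks_multiply]; simp [hM]) (Matrix.fromBlocks P 0 ξ G)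
  have e : Matrix.fromBlocks M 0 0 1 * Matrix.fromBlocks P 0 ξ G * Matrix.fromBlocks M' 0 0 1 =
      Matrix.fromBlocks (M * P * M') 0 (ξ * M') G := by
    rw [Matrix.fromBlocks_multiply, Matrix.fromBlocks_multiply]
    simp only [Matrix.mul_zero, Matrix.zero_mul, Matrix.mul_one, Matrix.one_mul, add_zero,
      zero_add]
  rw [← h, e]

/-- Conjugation by the unipotent element with blocks `v` on `A × C` and `y` on `C × C`. -/
theorem finrank_patternKer_conj_unipotent (hR : ∀ i j k, R i j → R j k → R i k)
    (hR' : ∀ i, R i i) (hB : ∀ c c', B c → R c c' → B c')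
    {v : Matrix A C K} (hv : ∀ a c, ¬ B c → v a c = 0)
    {y : Matrix C C K} (hy : y ∈ patternSpace K R) (hvy : v * y = 0) (hyy : y * y = 0)
    (P : Matrix A A K) (ξ : Matrix C A K) (G : Matrix C C K) :
    ∃ G', Module.finrank K (patternKer (glueRel A B R)
      (Matrix.fromBlocks (P + v * ξ) 0 (ξ + y * ξ) G')) =
    Module.finrank K (patternKer (glueRel A B R) (Matrix.fromBlocks P 0 ξ G)) := by
  have h1 : (1 : Matrix C C K) ∈ patternSpace K R := fun i j hij =>
    Matrix.one_apply_ne fun h => hij (h ▸ hR' i)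
  have h := finrank_patternKer_conj (K := K) (glueRel_trans (A := A) hR hB)
    (h := Matrix.fromBlocks 1 v 0 (1 + y)) (h' := Matrix.fromBlocks 1 (-v) 0 (1 - y))
    (fromBlocks_mem_patternSpace.mpr ⟨hv, rfl, add_mem h1 hy⟩)
    (fromBlocks_mem_patternSpace.mpr ⟨fun a c hc => by rw [Matrix.neg_apply, hv a c hc, neg_zero],
      rfl, sub_mem h1 hy⟩)
    (by
      rw [Matrix.fromBlocks_multiply, ← Matrix.fromBlocks_one]
      congr 1
      · simp
      · rw [Matrix.mul_sub, hvy]; simp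
      · simp
      · rw [Matrix.add_mul, Matrix.mul_sub, Matrix.mul_sub, hyy]; simp)
    (Matrix.fromBlocks P 0 ξ G)
  rw [Matrix.fromBlocks_multiply, Matrix.fromBlocks_multiply] at h
  refine ⟨_, Eq.trans (finrank_patternKer_fromBlocks_congr hR hB _ _ _ _ fun c _ a => ?_)
    (Eq.trans (congrArg (fun Z => Module.finrank K (patternKer (glueRel A B R)
      (Matrix.fromBlocks Z _ _ _))) ?_) h)⟩
  · rw [Matrix.mul_one, Matrix.mul_zero, add_zero, Matrix.add_mul, Matrix.one_mul, Matrix.zero_mul,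
      zero_add]
  · rw [Matrix.mul_one, Matrix.mul_zero, add_zero, Matrix.one_mul]

/-- The generic linear form on the abelian ideal of `A × B` matrices, for `|A| ≤ |B|`, can be moved
to the `0/1` form given by an embedding `e : A → B`. Its stabilizer is the pattern algebra of the
relation obtained from `R` by dropping the pairs in `(B ∖ e(A)) × e(A)`. -/
theorem patternIndex_glueRel_of_range_subset [Infinite K] (hR : ∀ i j k, R i j → R j k → R i k)
    (hR' : ∀ i, R i i) (hB : ∀ c c', B c → R c c' → B c')
    {e : A → C} (he : Function.Injective e)
    (heB : ∀ a, B (e a)) (hBe : ∀ c, B c → c ∉ Set.range e → ∀ a, R c (e a)) :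
    patternIndex K (glueRel A B R) = patternIndex K
      (fun c c' => R c c' ∧ ¬ (B c ∧ c ∉ Set.range e ∧ c' ∈ Set.range e)) := by
  classical
  apply le_antisymm
  · refine le_patternIndex fun G => ?_
    rw [← finrank_patternKer_glueRel_of_range_subset he heB hBe]
    exact patternIndex_le _ _
  · refine le_patternIndex_of_generic (fun F => (F.submatrix (Sum.inr ∘ e) Sum.inl).det)
      (fun F G => exists_polynomial_eval_eq_det _ _)
      (Matrix.fromBlocks 0 0 (matchingMatrix K e) 0) ?_ fun F hF => ?_
    · have : (Matrix.fromBlocks (0 : Matrix A A K) (0 : Matrix A C K) (matchingMatrix K e) 0).submatrix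
          (Sum.inr ∘ e) Sum.inl = 1 := by
        ext a a'
        simp [matchingMatrix, Matrix.one_apply, he.eq_iff]
      rw [this, Matrix.det_one]
      exact one_ne_zero
    set M := F.submatrix (Sum.inr ∘ e) Sum.inl with hM
    have hMu : IsUnit M.det := isUnit_iff_ne_zero.mpr hF
    have hMM : M * M⁻¹ = 1 := Matrix.mul_nonsing_inv M hMu
    set J := matchingMatrix K e with hJ
    rw [← Matrix.fromBlocks_toBlocks F, finrank_patternKer_fromBlocks_congr hR hB _ _ 0 _
      (fun _ _ _ => rfl), ← finrank_patternKer_conj_block hR hR' hB hMM]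
    set ξ := F.toBlocks₂₁ * M⁻¹ with hξ
    set P := M * F.toBlocks₁₁ * M⁻¹
    have hJξ : Jᵀ * ξ = 1 := by
      have : Jᵀ * F.toBlocks₂₁ = M := by
        ext a a'
        exact matchingMatrix_transpose_mul_apply _ _ _
      rw [hξ, ← Matrix.mul_assoc, this, hMM]
    -- `N` is the part of `ξ` in the rows of `B ∖ e(A)`
    let N : Matrix C A K := Matrix.of fun c a => if B c then (ξ - J) c a else 0
    have hN : Jᵀ * N = 0 := by
      rw [hJ, ← matchingMatrix_transpose_mul_eq_zero]
      rintro a _ ⟨a', rfl⟩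
      have h1 : ξ (e a') a = (1 : Matrix A A K) a' a := by
        rw [← hJξ, hJ, matchingMatrix_transpose_mul_apply]
      simp [N, h1, hJ, matchingMatrix, he.eq_iff, Matrix.one_apply]
    obtain ⟨G', hG'⟩ := finrank_patternKer_conj_unipotent (K := K) (A := A) hR hR' hB
      (v := -(P * Jᵀ)) (y := -(N * Jᵀ))
      (fun a c hc => by
        rw [Matrix.neg_apply, mul_matchingMatrix_transpose_apply_of_notMem, neg_zero]
        rintro ⟨a, rfl⟩
        exact hc (heB a))
      (fun c c' hc => by
        rw [Matrix.neg_apply, neg_eq_zero]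
        by_cases hc' : c' ∈ Set.range e
        · obtain ⟨a, rfl⟩ := hc'
          have hNc : ∀ a, N c a = 0 := fun a' => by
            by_cases hBc : B c
            · have hce : c ∈ Set.range e := by
                by_contra hce
                exact hc (hBe c hBc hce a)
              exact (matchingMatrix_transpose_mul_eq_zero (K := K) N).mpr hN a' c hce
            · simp [N, hBc]
          simp [Matrix.mul_apply, hNc]
        · exact mul_matchingMatrix_transpose_apply_of_notMem _ hc' _)
      (by rw [Matrix.neg_mul, Matrix.mul_neg, Matrix.mul_assoc, ← Matrix.mul_assoc Jᵀ, hN]; simp)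
      (by rw [Matrix.neg_mul, Matrix.mul_neg, Matrix.mul_assoc, ← Matrix.mul_assoc Jᵀ, hN]; simp)
      P ξ F.toBlocks₂₂
    rw [← hG', Matrix.neg_mul, Matrix.neg_mul, Matrix.mul_assoc, hJξ, Matrix.mul_one,
      add_neg_cancel, Matrix.mul_assoc, hJξ, Matrix.mul_one,
      finrank_patternKer_fromBlocks_congr (ξ' := J) hR hB 0 0 0 G' fun c hc a => by
        simp [N, hc],
      finrank_patternKer_glueRel_of_range_subset he heB hBe]
    exact patternIndex_le _ _

/-- The generic linear form on the abelian ideal of `(A ⊕ D) × B` matrices, for `|B| = |D|`, can be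
moved to the `0/1` form given by a bijection `e : D → B`. In its stabilizer the block on `D` is
determined by that on `B`, and the `A × D` block plays the role of the `A × B` block. -/
theorem patternIndex_glueRel_of_range_eq [Infinite K] (hR : ∀ i j k, R i j → R j k → R i k)
    (hR' : ∀ i, R i i) (hB : ∀ c c', B c → R c c' → B c')
    {e : D → C} (he : Function.Injective e) (heB : ∀ c, B c ↔ c ∈ Set.range e) :
    patternIndex K (glueRel (A ⊕ D) B R) = patternIndex K (glueRel A B R) := by
  classical
  set J := matchingMatrix K e with hJ
  have hJJ : Jᵀ * J = 1 := matchingMatrix_transpose_mul_self he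
  apply le_antisymm
  · refine le_patternIndex fun F => ?_
    rw [← Matrix.fromBlocks_toBlocks F, finrank_patternKer_fromBlocks_congr
      (ξ' := J * (Jᵀ * F.toBlocks₂₁)) hR hB _ _ 0 _ fun c hc a => ?_,
      ← finrank_patternKer_glueRel_of_range_eq he heB]
    · exact patternIndex_le _ _
    · obtain ⟨d, rfl⟩ := (heB c).mp hc
      rw [hJ, matchingMatrix_mul_apply he, matchingMatrix_transpose_mul_apply]
  · refine le_patternIndex_of_generic
      (fun F => (F.submatrix (Sum.inr ∘ e) (Sum.inl ∘ Sum.inr)).det)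
      (fun F G => exists_polynomial_eval_eq_det _ _)
      (Matrix.fromBlocks 0 0 (Matrix.fromCols 0 J) 0) ?_ fun F hF => ?_
    · have : (Matrix.fromBlocks (0 : Matrix (A ⊕ D) (A ⊕ D) K) (0 : Matrix (A ⊕ D) C K)
          (Matrix.fromCols (0 : Matrix C A K) J) 0).submatrix
          (Sum.inr ∘ e) (Sum.inl ∘ Sum.inr) = 1 := by
        ext a a'
        simp [hJ, matchingMatrix, Matrix.one_apply, he.eq_iff]
      rw [this, Matrix.det_one]
      exact one_ne_zero
    set M := F.submatrix (Sum.inr ∘ e) (Sum.inl ∘ Sum.inr) with hM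
    have hMu : IsUnit M.det := isUnit_iff_ne_zero.mpr hF
    have hMM : M * M⁻¹ = 1 := Matrix.mul_nonsing_inv M hMu
    let N : Matrix D A K := F.submatrix (Sum.inr ∘ e) (Sum.inl ∘ Sum.inl)
    -- `H` is the identity in the rows of `A`, and `ξ` in those of `D`
    obtain ⟨H, H', hH, hNM⟩ : ∃ H H' : Matrix (A ⊕ D) (A ⊕ D) K, H * H' = 1 ∧
        Matrix.fromCols N M * H' = Matrix.fromCols 0 1 := by
      refine ⟨Matrix.fromBlocks 1 0 N M, Matrix.fromBlocks 1 0 (-(M⁻¹ * N)) M⁻¹, ?_, ?_⟩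
      · rw [Matrix.fromBlocks_multiply, ← Matrix.fromBlocks_one, Matrix.mul_neg M,
          ← Matrix.mul_assoc M, hMM]
        simp
      · rw [Matrix.fromCols_mul_fromBlocks, Matrix.mul_neg, ← Matrix.mul_assoc, hMM]
        simp
    rw [← Matrix.fromBlocks_toBlocks F, finrank_patternKer_fromBlocks_congr hR hB _ _ 0 _
      (fun _ _ _ => rfl), ← finrank_patternKer_conj_block hR hR' hB hH]
    set ξ : Matrix C (A ⊕ D) K := F.toBlocks₂₁ * H' with hξ
    set P : Matrix (A ⊕ D) (A ⊕ D) K :=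
      H * F.toBlocks₁₁ * H'
    have hJξ : Jᵀ * ξ = Matrix.fromCols (0 : Matrix D A K) 1 := by
      have : Jᵀ * F.toBlocks₂₁ = Matrix.fromCols N M := by
        ext d (a | d')
        · exact matchingMatrix_transpose_mul_apply _ _ _
        · exact matchingMatrix_transpose_mul_apply _ _ _
      rw [hξ, ← Matrix.mul_assoc, this, hNM]
    obtain ⟨G', hG'⟩ := finrank_patternKer_conj_unipotent (K := K) (A := A ⊕ D) hR hR' hB
      (v := -(Matrix.fromRows P.toBlocks₁₂ P.toBlocks₂₂ * Jᵀ)) (y := 0)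
      (fun a c hc => by
        rw [Matrix.neg_apply, mul_matchingMatrix_transpose_apply_of_notMem, neg_zero]
        rwa [← heB])
      (zero_mem _) (Matrix.mul_zero _) (Matrix.mul_zero _) P ξ F.toBlocks₂₂
    have hP : P + -(Matrix.fromRows P.toBlocks₁₂ P.toBlocks₂₂ * Jᵀ) * ξ =
        Matrix.fromBlocks P.toBlocks₁₁ 0 P.toBlocks₂₁ 0 := by
      rw [Matrix.neg_mul, Matrix.mul_assoc, hJξ, Matrix.fromRows_mul_fromCols]
      ext (a | d) (a' | d') <;>
        simp [Matrix.toBlocks₁₁, Matrix.toBlocks₁₂, Matrix.toBlocks₂₁, Matrix.toBlocks₂₂]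
    rw [← hG', hP, Matrix.zero_mul, add_zero,
      finrank_patternKer_fromBlocks_congr (ξ' := Matrix.fromCols 0 J) hR hB _ 0 0 G' fun c hc a =>
        ?_, finrank_patternKer_glueRel_of_range_eq he heB]
    · exact patternIndex_le _ _
    · obtain ⟨d, rfl⟩ := (heB c).mp hc
      have h1 := matchingMatrix_transpose_mul_apply (K := K) (e := e) ξ d a
      have h2 := matchingMatrix_transpose_mul_apply (K := K) (e := e) (Matrix.fromCols 0 J) d a
      rw [← h1, ← h2, ← hJ, hJξ, Matrix.mul_fromCols, hJJ, Matrix.mul_zero]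

omit [DecidableEq A] [DecidableEq C] in
/-- The pattern algebra of a disjoint union of relations is a direct sum. -/
theorem patternIndex_glueRel_false (hR : ∀ i j k, R i j → R j k → R i k) :
    patternIndex K (glueRel A (fun _ => False) R) =
      patternIndex K (fun _ _ : A => True) + patternIndex K R := by
  have hmem : ∀ (P : Matrix A A K) (ξ : Matrix C A K) (G : Matrix C C K)
      (X : Matrix A A K) (v : Matrix A C K) (w : Matrix C A K) (y : Matrix C C K),
      Matrix.fromBlocks X v w y ∈ patternKer (glueRel A (fun _ => False) R)
        (Matrix.fromBlocks P 0 ξ G) ↔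
      v = 0 ∧ w = 0 ∧ X ∈ patternKer (fun _ _ => True) P ∧ y ∈ patternKer R G := by
    intro P ξ G X v w y
    rw [fromBlocks_mem_patternKer]
    constructor
    · rintro ⟨⟨h1, h2, h3⟩, h4, -, h5⟩
      obtain rfl : v = 0 := by
        ext a c
        exact h1 a c id
      simp only [Matrix.zero_mul, Matrix.mul_zero, add_zero, zero_add] at h4 h5
      refine ⟨rfl, h2, ⟨fun i j h => absurd trivial h, fun i j _ => ?_⟩, h3, h5⟩
      rw [h4, Matrix.zero_apply]
    · rintro ⟨rfl, h2, h3, h4⟩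
      refine ⟨⟨fun _ _ _ => rfl, h2, h4.1⟩, ?_, fun _ _ h => h.elim, ?_⟩
      · rw [Matrix.zero_mul, add_zero]
        ext i j
        exact h3.2 j i trivial
      · rw [Matrix.mul_zero, zero_add]
        exact h4.2
  have key : ∀ (P : Matrix A A K) (ξ : Matrix C A K) (G : Matrix C C K),
      Module.finrank K (patternKer (glueRel A (fun _ => False) R) (Matrix.fromBlocks P 0 ξ G)) =
      Module.finrank K (patternKer (fun _ _ => True) P) + Module.finrank K (patternKer R G) := by
    intro P ξ G
    rw [← Module.finrank_prod]
    symm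
    let φ : (patternKer (fun _ _ => True) P × patternKer R G) →ₗ[K]
        patternKer (glueRel A (fun _ => False) R) (Matrix.fromBlocks P 0 ξ G) :=
      { toFun := fun z => ⟨Matrix.fromBlocks z.1.1 0 0 z.2.1,
          (hmem _ _ _ _ _ _ _).mpr ⟨rfl, rfl, z.1.2, z.2.2⟩⟩
        map_add' := fun x y => Subtype.ext (by simp [Matrix.fromBlocks_add])
        map_smul' := fun c x => Subtype.ext (by simp [Matrix.fromBlocks_smul]) }
    refine LinearEquiv.finrank_eq (LinearEquiv.ofBijective φ ⟨?_, ?_⟩)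
    · rintro ⟨x, y⟩ ⟨x', y'⟩ h
      have h' := Matrix.fromBlocks_inj.mp (congrArg Subtype.val h)
      exact Prod.ext (Subtype.ext h'.1) (Subtype.ext h'.2.2.2)
    · rintro ⟨z, hz⟩
      have hz' := hz
      rw [← Matrix.fromBlocks_toBlocks z, hmem] at hz'
      refine ⟨⟨⟨_, hz'.2.2.1⟩, ⟨_, hz'.2.2.2⟩⟩, Subtype.ext ?_⟩
      change Matrix.fromBlocks z.toBlocks₁₁ 0 0 z.toBlocks₂₂ = z
      nth_rewrite 3 [← Matrix.fromBlocks_toBlocks z]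
      rw [hz'.1, hz'.2.1]
  apply le_antisymm
  · obtain ⟨P, hP⟩ := exists_patternIndex_eq K (fun _ _ : A => True)
    obtain ⟨G, hG⟩ := exists_patternIndex_eq K R
    rw [← hP, ← hG, ← key P 0 G]
    exact patternIndex_le _ _
  · refine le_patternIndex fun F => ?_
    rw [← Matrix.fromBlocks_toBlocks F, finrank_patternKer_fromBlocks_congr hR
      (fun _ _ h _ => h) _ _ 0 _ (fun _ _ _ => rfl), key]
    exact add_le_add (patternIndex_le _ _) (patternIndex_le _ _)

end GlueIndex

/-- The matrix with columns `v, P v, …, P ^ (k - 1) v`, where `v` is the all-ones vector. -/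
def krylovMatrix {S : Type*} [CommRing S] {k : ℕ} (P : Matrix (Fin k) (Fin k) S) :
    Matrix (Fin k) (Fin k) S :=
  Matrix.of fun i j => ((P ^ (j : ℕ)) *ᵥ fun _ => 1) i

/-- The index of `𝔤𝔩(k)` is `k`. Generically `P` has a cyclic vector, so that `1, P, …, P ^ (k - 1)`
are linearly independent elements of its centralizer; and the centralizer of a diagonal matrix with
distinct entries is the space of diagonal matrices. -/
theorem patternIndex_full {K : Type*} [Field K] [Infinite K] (k : ℕ) :
    patternIndex K (fun _ _ : Fin k => True) = k := by
  obtain ⟨d, hd⟩ : ∃ d : Fin k → K, Function.Injective d :=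
    ⟨fun i => Infinite.natEmbedding K i, fun i j h => Fin.ext ((Infinite.natEmbedding K).injective h)⟩
  have hmem : ∀ P X : Matrix (Fin k) (Fin k) K,
      X ∈ patternKer (fun _ _ => True) P ↔ P * X = X * P := by
    intro P X
    rw [mem_patternKer, ← sub_eq_zero (a := P * X)]
    constructor
    · rintro ⟨-, h⟩
      ext i j
      exact h j i trivial
    · intro h
      refine ⟨fun _ _ h => absurd trivial h, fun i j _ => ?_⟩
      rw [h, Matrix.zero_apply]
  apply le_antisymm
  · refine (patternIndex_le _ (Matrix.diagonal d)).trans ?_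
    have := LinearMap.finrank_le_finrank_of_injective
      (f := (Matrix.diagLinearMap (Fin k) K K).domRestrict
        (patternKer (fun _ _ => True) (Matrix.diagonal d))) (by
      rw [injective_iff_map_eq_zero]
      rintro ⟨X, hX⟩ h0
      refine Subtype.ext ?_
      change X = 0
      ext i j
      by_cases hij : i = j
      · subst hij
        exact congrFun h0 i
      · have := congrFun (congrFun ((hmem _ _).mp hX) i) j
        rw [Matrix.diagonal_mul, Matrix.mul_diagonal, mul_comm, ← sub_eq_zero, ← mul_sub,
          mul_eq_zero] at this
        exact this.resolve_right (sub_ne_zero.mpr fun h => hij (hd h)))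
    rwa [Module.finrank_fin_fun] at this
  · refine le_patternIndex_of_generic (fun P => (krylovMatrix P).det) (fun F G => ?_)
      (Matrix.diagonal d) ?_ fun P hP => ?_
    · refine ⟨(krylovMatrix (F.map Polynomial.C + (Polynomial.X : Polynomial K) •
        G.map Polynomial.C)).det, fun t => ?_⟩
      rw [← Polynomial.coe_evalRingHom, RingHom.map_det]
      congr 1
      have h1 : (Polynomial.evalRingHom t).mapMatrix (F.map Polynomial.C +
          (Polynomial.X : Polynomial K) • G.map Polynomial.C) = F + t • G := by
        ext i j
        simp [mul_comm t]
      ext i j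
      rw [← h1, RingHom.mapMatrix_apply, Matrix.map_apply, krylovMatrix, krylovMatrix,
        Matrix.of_apply, Matrix.of_apply, RingHom.map_mulVec, ← RingHom.mapMatrix_apply, map_pow]
      have h2 : (Polynomial.evalRingHom t) ∘ (fun _ : Fin k => (1 : Polynomial K)) =
          fun _ => 1 := funext fun _ => map_one _
      rw [h2]
    · have : krylovMatrix (Matrix.diagonal d) = Matrix.vandermonde d := by
        ext i j
        simp [krylovMatrix, Matrix.diagonal_pow, Matrix.mulVec_diagonal, Matrix.vandermonde_apply]
      rw [this]
      exact Matrix.det_vandermonde_ne_zero_iff.mpr hd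
    · let w : Fin k → patternKer (fun _ _ : Fin k => True) P := fun j =>
        ⟨P ^ (j : ℕ), (hmem _ _).mpr (by rw [← pow_succ, ← pow_succ'])⟩
      have hw : LinearIndependent K w := by
        have hcol : LinearIndependent K (krylovMatrix P).col :=
          Matrix.linearIndependent_cols_iff_isUnit.mpr
            ((Matrix.isUnit_iff_isUnit_det _).mpr (isUnit_iff_ne_zero.mpr hP))
        let ev : patternKer (fun _ _ : Fin k => True) P →ₗ[K] (Fin k → K) :=
          ((Matrix.mulVecBilin K K).flip fun _ => 1) ∘ₗ (Submodule.subtype _)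
        exact LinearIndependent.of_comp ev hcol
      have := hw.fintype_card_le_finrank
      rwa [Fintype.card_fin] at this

/-! ### Seaweed relations -/

section SeaweedRel

/-- For a list `a` of block sizes: `i < j`, and the positions `i` and `j` lie in different blocks. -/
def Separated (a : List ℕ) (i j : ℕ) : Prop := ∃ m, i < (a.take m).sum ∧ (a.take m).sum ≤ j

theorem Separated.lt {a : List ℕ} {i j : ℕ} : Separated a i j → i < j := fun ⟨_, h, h'⟩ =>
  h.trans_le h'

theorem Separated.or {a : List ℕ} {i k : ℕ} (h : Separated a i k) (j : ℕ) :
    Separated a i j ∨ Separated a j k := by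
  obtain ⟨m, h, h'⟩ := h
  rcases lt_or_ge j (a.take m).sum with hj | hj
  · exact .inr ⟨m, hj, h'⟩
  · exact .inl ⟨m, h, hj⟩

theorem separated_cons {k : ℕ} {a : List ℕ} {i j : ℕ} :
    Separated (k :: a) i j ↔ ∃ m, i < k + (a.take m).sum ∧ k + (a.take m).sum ≤ j := by
  constructor
  · rintro ⟨_ | m, h⟩
    · exact absurd h.1 (by simp)
    · exact ⟨m, by simpa using h⟩
  · rintro ⟨m, h⟩
    exact ⟨m + 1, by simpa using h⟩

theorem separated_cons_of_lt {k : ℕ} {a : List ℕ} {i j : ℕ} (hj : j < k) :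
    ¬ Separated (k :: a) i j := by
  rw [separated_cons]
  rintro ⟨m, h, h'⟩
  omega

theorem separated_cons_of_lt_of_le {k : ℕ} {a : List ℕ} {i j : ℕ} (hi : i < k) (hj : k ≤ j) :
    Separated (k :: a) i j :=
  separated_cons.mpr ⟨0, by simpa using hi, by simpa using hj⟩

theorem separated_cons_add {k l : ℕ} {a : List ℕ} {i j : ℕ} :
    Separated ((k + l) :: a) (k + i) (k + j) ↔ Separated (l :: a) i j := by
  rw [separated_cons, separated_cons]
  refine exists_congr fun m => ?_
  omega

theorem separated_zero_cons {a : List ℕ} {i j : ℕ} : Separated (0 :: a) i j ↔ Separated a i j := by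
  rw [separated_cons]
  simp only [zero_add]
  rfl

theorem separated_cons_cons {k l : ℕ} {a : List ℕ} {i j : ℕ} :
    Separated (k :: l :: a) i j ↔ (i < k ∧ k ≤ j) ∨ Separated ((k + l) :: a) i j := by
  rw [separated_cons, separated_cons]
  constructor
  · rintro ⟨_ | m, h⟩
    · exact .inl (by simpa using h)
    · exact .inr ⟨m, by simpa [add_assoc] using h⟩
  · rintro (h | ⟨m, h⟩)
    · exact ⟨0, by simpa using h⟩
    · exact ⟨m + 1, by simpa [add_assoc] using h⟩

/-- The pattern of the seaweed algebra of type `a / b`: below the diagonal it consists of the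
positions in the blocks of `a`, above the diagonal of those in the blocks of `b`. -/
def seaweedRel (a b : List ℕ) (n : ℕ) : Fin n → Fin n → Prop := fun i j =>
  ¬ Separated a j i ∧ ¬ Separated b i j

theorem seaweedRel_refl (a b : List ℕ) (n : ℕ) (i : Fin n) : seaweedRel a b n i i :=
  ⟨fun h => h.lt.false, fun h => h.lt.false⟩

theorem seaweedRel_trans (a b : List ℕ) (n : ℕ) (i j k : Fin n) (h : seaweedRel a b n i j)
    (h' : seaweedRel a b n j k) : seaweedRel a b n i k :=
  ⟨fun hs => (hs.or j).elim h'.1 h.1, fun hs => (hs.or j).elim h.2 h'.2⟩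

/-- The first block of `a`, if it is not longer than that of `b`, is glued to the seaweed relation of
the remaining positions. -/
theorem seaweedRel_cons_iff {k l m : ℕ} (hkl : k ≤ l) (a b : List ℕ) (x y : Fin k ⊕ Fin m) :
    glueRel (Fin k) (fun c : Fin m => (c : ℕ) < l - k) (seaweedRel a ((l - k) :: b) m) x y ↔
      seaweedRel (k :: a) (l :: b) (k + m) (finSumFinEquiv x) (finSumFinEquiv y) := by
  rcases x with i | c <;> rcases y with j | c'
  · simp only [glueRel, finSumFinEquiv_apply_left, true_iff, seaweedRel]
    exact ⟨separated_cons_of_lt i.2, separated_cons_of_lt (j.2.trans_le hkl)⟩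
  · simp only [glueRel, finSumFinEquiv_apply_left, finSumFinEquiv_apply_right, seaweedRel,
      Fin.val_castAdd, Fin.val_natAdd]
    have hi := i.2
    constructor
    · exact fun h => ⟨separated_cons_of_lt hi, separated_cons_of_lt (by omega)⟩
    · rintro ⟨-, h⟩
      by_contra hc
      exact h (separated_cons_of_lt_of_le (by omega) (by omega))
  · simp only [glueRel, finSumFinEquiv_apply_left, finSumFinEquiv_apply_right, seaweedRel,
      Fin.val_castAdd, Fin.val_natAdd, false_iff, not_and_or, not_not]
    exact .inl (separated_cons_of_lt_of_le j.2 (Nat.le_add_right _ _))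
  · simp only [glueRel, finSumFinEquiv_apply_right, seaweedRel, Fin.val_natAdd]
    obtain ⟨l, rfl⟩ := Nat.exists_eq_add_of_le hkl
    rw [Nat.add_sub_cancel_left, separated_cons_add, ← add_zero k, add_assoc, add_assoc,
      separated_cons_add, separated_zero_cons, zero_add, zero_add]

end SeaweedRel

/-! ### The index of seaweed algebras of `𝔤𝔩(n)` -/

section SeaweedIndex

variable (K : Type*) [Field K]

/-- The index of the seaweed subalgebra of `𝔤𝔩(n)` of type `a / b`. -/
noncomputable def seaweedIndex (a b : List ℕ) (n : ℕ) : ℕ := patternIndex K (seaweedRel a b n)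

theorem seaweedIndex_comm (a b : List ℕ) (n : ℕ) : seaweedIndex K a b n = seaweedIndex K b a n := by
  rw [seaweedIndex, ← patternIndex_swap]
  exact patternIndex_congr (Equiv.refl _) fun _ _ => and_comm

theorem seaweedIndex_zero_cons (a b : List ℕ) (n : ℕ) :
    seaweedIndex K (0 :: a) b n = seaweedIndex K a b n :=
  patternIndex_congr (Equiv.refl _) fun _ _ =>
    and_congr (not_congr separated_zero_cons) Iff.rfl

theorem seaweedIndex_cons_eq_glueRel {k l : ℕ} (hkl : k ≤ l) (a b : List ℕ) (m : ℕ) :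
    seaweedIndex K (k :: a) (l :: b) (k + m) = patternIndex K (glueRel (Fin k)
      (fun c : Fin m => (c : ℕ) < l - k) (seaweedRel a ((l - k) :: b) m)) :=
  (patternIndex_congr finSumFinEquiv (seaweedRel_cons_iff hkl a b)).symm

theorem seaweedRel_cons_closed {k m : ℕ} {a b : List ℕ} (c c' : Fin m) (hc : (c : ℕ) < k)
    (h : seaweedRel a (k :: b) m c c') : (c' : ℕ) < k := by
  by_contra hc'
  exact h.2 (separated_cons_of_lt_of_le hc (not_lt.mp hc'))

variable [Infinite K]

theorem seaweedIndex_cons_cons_self (k : ℕ) (a b : List ℕ) (m : ℕ) :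
    seaweedIndex K (k :: a) (k :: b) (k + m) = k + seaweedIndex K a b m := by
  have h1 : patternIndex K (glueRel (Fin k) (fun c : Fin m => (c : ℕ) < k - k)
      (seaweedRel a ((k - k) :: b) m)) = patternIndex K (glueRel (Fin k) (fun _ : Fin m => False)
      (seaweedRel a (0 :: b) m)) := by
    rw [Nat.sub_self]
    simp only [Nat.not_lt_zero]
  rw [seaweedIndex_cons_eq_glueRel K le_rfl, h1,
    patternIndex_glueRel_false (seaweedRel_trans _ _ _), patternIndex_full]
  congr 1
  exact (seaweedIndex_comm K _ _ _).trans
    ((seaweedIndex_zero_cons K _ _ _).trans (seaweedIndex_comm K _ _ _))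

/-- Matching the first block of `a` with the last `k` positions of the first block of `b`. -/
theorem seaweedIndex_cons_cons_of_two_mul_le {k l m : ℕ} (hkl : 2 * k ≤ l) (hl : l ≤ k + m)
    (a b : List ℕ) : seaweedIndex K (k :: a) (l :: b) (k + m) =
      seaweedIndex K a ((l - 2 * k) :: k :: b) m := by
  let e : Fin k → Fin m := fun i => ⟨l - 2 * k + i, by omega⟩
  have he : Function.Injective e := fun i j h => by
    have : l - 2 * k + (i : ℕ) = l - 2 * k + j := congrArg Fin.val h
    exact Fin.ext (by omega)
  have hrange : ∀ c : Fin m, c ∈ Set.range e ↔ l - 2 * k ≤ c ∧ (c : ℕ) < l - k := by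
    intro c
    constructor
    · rintro ⟨i, rfl⟩
      have := i.2
      change l - 2 * k ≤ l - 2 * k + (i : ℕ) ∧ l - 2 * k + (i : ℕ) < l - k
      omega
    · rintro ⟨h1, h2⟩
      refine ⟨⟨c - (l - 2 * k), by omega⟩, Fin.ext ?_⟩
      change l - 2 * k + (c - (l - 2 * k)) = c
      omega
  rw [seaweedIndex_cons_eq_glueRel K (by omega), patternIndex_glueRel_of_range_subset
    (seaweedRel_trans _ _ _) (seaweedRel_refl _ _ _) seaweedRel_cons_closed he
    (fun i => ((hrange _).mp ⟨i, rfl⟩).2)]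
  · refine patternIndex_congr (Equiv.refl _) fun c c' => ?_
    simp only [Equiv.refl_apply, seaweedRel, hrange]
    rw [separated_cons_cons, show l - 2 * k + k = l - k by omega]
    constructor
    · rintro ⟨⟨h1, h2⟩, h3⟩
      refine ⟨h1, ?_⟩
      rintro (h | h)
      · by_cases hc' : (c' : ℕ) < l - k
        · exact h3 ⟨by omega, by omega, h.2, hc'⟩
        · exact h2 (separated_cons_of_lt_of_le (by omega) (by omega))
      · exact h2 h
    · rintro ⟨h1, h2⟩
      exact ⟨⟨h1, fun h => h2 (.inr h)⟩, fun h => h2 (.inl ⟨by omega, by omega⟩)⟩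
  · intro c hc hce i
    rw [hrange] at hce
    have hi := (hrange _).mp ⟨i, rfl⟩
    exact ⟨fun h => by have := h.lt; omega, separated_cons_of_lt hi.2⟩

/-- Matching the last `l - k` positions of the first block of `a` with the positions of the first
block of `b` beyond it. -/
theorem seaweedIndex_cons_cons_of_le_two_mul {k l m : ℕ} (hkl : k ≤ l) (hl : l ≤ 2 * k)
    (hm : l ≤ k + m) (a b : List ℕ) : seaweedIndex K (k :: a) (l :: b) (k + m) =
      seaweedIndex K ((2 * k - l) :: a) (k :: b) (2 * k - l + m) := by
  rw [seaweedIndex_cons_eq_glueRel K hkl, seaweedIndex_cons_eq_glueRel K (by omega),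
    show k - (2 * k - l) = l - k by omega]
  let e : Fin (l - k) → Fin m := Fin.castLE (by omega)
  have he : Function.Injective e := Fin.castLE_injective _
  rw [← patternIndex_glueRel_of_range_eq (A := Fin (2 * k - l)) (seaweedRel_trans _ _ _)
    (seaweedRel_refl _ _ _) seaweedRel_cons_closed he fun c =>
      ⟨fun h => ⟨⟨c, h⟩, rfl⟩, by rintro ⟨i, rfl⟩; exact i.2⟩]
  let f : Fin k ≃ Fin (2 * k - l) ⊕ Fin (l - k) :=
    (finCongr (by omega)).trans finSumFinEquiv.symm
  refine patternIndex_congr (Equiv.sumCongr f (Equiv.refl _)) ?_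
  rintro (i | i) (j | j) <;> exact Iff.rfl

omit [Infinite K] in
theorem seaweedIndex_nil (b : List ℕ) : seaweedIndex K [] b 0 = 0 := by
  refine Nat.le_zero.mp ((patternIndex_le _ 0).trans ?_)
  refine (Submodule.finrank_le _).trans ?_
  simp [Module.finrank_matrix]

theorem seaweedIndex_le (a b : List ℕ) (n : ℕ) (ha : a.sum = n) (hb : b.sum = n) :
    seaweedIndex K a b n ≤ n := by
  -- the reductions decrease the sum of `n` and the numbers of parts; parts may be zero
  induction hN : n + a.length + b.length using Nat.strong_induction_on generalizing a b n with
  | _ N ih =>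
  have key : ∀ k l a b, (k :: a : List ℕ).sum = n → (l :: b : List ℕ).sum = n →
      n + (k :: a).length + (l :: b).length = N → 0 < k → k ≤ l →
      seaweedIndex K (k :: a) (l :: b) n ≤ n := by
    intro k l a b ha hb hN hk hkl
    simp only [List.sum_cons, List.length_cons] at ha hb hN
    obtain ⟨m, rfl⟩ : ∃ m, n = k + m := ⟨a.sum, ha.symm⟩
    rcases hkl.eq_or_lt with rfl | hkl'
    · have := ih _ (by omega) a b m (by omega) (by omega) rfl
      rw [seaweedIndex_cons_cons_self]
      omega
    rcases le_total (2 * k) l with h2 | h2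
    · have := ih _ (by simp only [List.length_cons]; omega) a ((l - 2 * k) :: k :: b) m (by omega)
        (by simp only [List.sum_cons]; omega) rfl
      rw [seaweedIndex_cons_cons_of_two_mul_le K h2 (by omega)]
      omega
    · have := ih _ (by simp only [List.length_cons]; omega) ((2 * k - l) :: a) (k :: b)
        (2 * k - l + m) (by simp only [List.sum_cons]; omega)
        (by simp only [List.sum_cons]; omega) rfl
      rw [seaweedIndex_cons_cons_of_le_two_mul K hkl h2 (by omega)]
      omega
  rcases a with _ | ⟨k, a⟩
  · obtain rfl : n = 0 := by simpa using ha.symm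
    exact (seaweedIndex_nil K b).le
  rcases b with _ | ⟨l, b⟩
  · obtain rfl : n = 0 := by simpa using hb.symm
    rw [seaweedIndex_comm]
    exact (seaweedIndex_nil K _).le
  rcases Nat.eq_zero_or_pos k with rfl | hk
  · rw [seaweedIndex_zero_cons]
    refine ih _ ?_ a _ n (by simpa using ha) hb rfl
    simp only [List.length_cons] at hN ⊢
    omega
  rcases Nat.eq_zero_or_pos l with rfl | hl
  · rw [seaweedIndex_comm, seaweedIndex_zero_cons]
    refine ih _ ?_ b _ n (by simpa using hb) ha rfl
    simp only [List.length_cons] at hN ⊢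
    omega
  rcases le_total k l with h | h
  · exact key k l a b ha hb hN hk h
  · rw [seaweedIndex_comm]
    exact key l k b a hb ha (by omega) hl h

/-- The difference between `n` and the index of the seaweed subalgebra of `𝔤𝔩(n)` of type `a / b`,
where `n` is the sum of the parts of `a`, and is meant to be that of the parts of `b`, too. -/
noncomputable def seaweedDefect (a b : List ℕ) : ℕ := a.sum - seaweedIndex K a b a.sum

omit [Infinite K] in
theorem seaweedDefect_comm {a b : List ℕ} (h : a.sum = b.sum) :
    seaweedDefect K a b = seaweedDefect K b a := by
  rw [seaweedDefect, seaweedDefect, h, seaweedIndex_comm]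

omit [Infinite K] in
theorem seaweedDefect_zero_cons_right (a b : List ℕ) :
    seaweedDefect K a (0 :: b) = seaweedDefect K a b := by
  rw [seaweedDefect, seaweedIndex_comm, seaweedIndex_zero_cons, seaweedIndex_comm, seaweedDefect]

omit [Infinite K] in
theorem seaweedDefect_nil : seaweedDefect K [] [] = 0 := by simp [seaweedDefect]

theorem seaweedDefect_cons_cons_self (k : ℕ) (a b : List ℕ) :
    seaweedDefect K (k :: a) (k :: b) = seaweedDefect K a b := by
  rw [seaweedDefect, List.sum_cons, seaweedIndex_cons_cons_self, seaweedDefect]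
  omega

theorem seaweedDefect_cons_cons_of_two_mul_le {k l : ℕ} {a b : List ℕ}
    (h : (k :: a).sum = (l :: b).sum) (hkl : 2 * k ≤ l) :
    seaweedDefect K (k :: a) (l :: b) = k + seaweedDefect K a ((l - 2 * k) :: k :: b) := by
  simp only [List.sum_cons] at h
  rw [seaweedDefect, List.sum_cons, seaweedIndex_cons_cons_of_two_mul_le K hkl (by omega),
    seaweedDefect]
  have := seaweedIndex_le K a ((l - 2 * k) :: k :: b) a.sum rfl
    (by simp only [List.sum_cons]; omega)
  omega

theorem seaweedDefect_cons_cons_of_le_two_mul {k l : ℕ} {a b : List ℕ}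
    (h : (k :: a).sum = (l :: b).sum) (hkl : k ≤ l) (hl : l ≤ 2 * k) :
    seaweedDefect K (k :: a) (l :: b) =
      (l - k) + seaweedDefect K ((2 * k - l) :: a) (k :: b) := by
  simp only [List.sum_cons] at h
  rw [seaweedDefect, List.sum_cons, seaweedIndex_cons_cons_of_le_two_mul K hkl hl (by omega),
    seaweedDefect, List.sum_cons]
  have := seaweedIndex_le K ((2 * k - l) :: a) (k :: b) (2 * k - l + a.sum)
    (by simp only [List.sum_cons]) (by simp only [List.sum_cons]; omega)
  omega

theorem le_seaweedDefect_cons_cons {k l : ℕ} {a b : List ℕ}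
    (h : (k :: a).sum = (l :: b).sum) (hkl : k < l) : k ≤ seaweedDefect K (k :: a) (l :: b) := by
  induction l using Nat.strong_induction_on generalizing k a b with
  | _ l ih =>
  rcases le_total (2 * k) l with h2 | h2
  · rw [seaweedDefect_cons_cons_of_two_mul_le K h h2]
    omega
  · rw [seaweedDefect_cons_cons_of_le_two_mul K h hkl.le h2]
    have := ih k hkl (k := 2 * k - l) (a := a) (b := b)
      (by simp only [List.sum_cons] at h ⊢; omega) (by omega)
    omega

theorem min_le_seaweedDefect_cons_cons {k l : ℕ} {a b : List ℕ}
    (h : (k :: a).sum = (l :: b).sum) (hkl : k ≠ l) :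
    min k l ≤ seaweedDefect K (k :: a) (l :: b) := by
  rcases hkl.lt_or_gt with hlt | hlt
  · exact (min_le_left _ _).trans (le_seaweedDefect_cons_cons K h hlt)
  · rw [seaweedDefect_comm K h]
    exact (min_le_right _ _).trans (le_seaweedDefect_cons_cons K h.symm hlt)

theorem seaweedDefect_eq_zero_iff {a b : List ℕ} (ha : ∀ k ∈ a, 0 < k) (hb : ∀ k ∈ b, 0 < k)
    (h : a.sum = b.sum) : seaweedDefect K a b = 0 ↔ a = b := by
  induction a generalizing b with
  | nil =>
    rcases b with _ | ⟨l, b⟩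
    · simp [seaweedDefect_nil]
    · have := hb l (by simp)
      simp only [List.sum_cons, List.sum_nil] at h
      omega
  | cons k a ih =>
    have hk := ha k (by simp)
    rcases b with _ | ⟨l, b⟩
    · simp only [List.sum_cons, List.sum_nil] at h
      omega
    have hl := hb l (by simp)
    rcases eq_or_ne k l with rfl | hkl
    · rw [seaweedDefect_cons_cons_self, List.cons_inj_right]
      exact ih (fun x hx => ha x (List.mem_cons_of_mem _ hx))
        (fun x hx => hb x (List.mem_cons_of_mem _ hx)) (by simpa using h)
    · have := min_le_seaweedDefect_cons_cons K h hkl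
      have : 0 < min k l := lt_min hk hl
      constructor
      · omega
      · intro hab
        exact absurd (List.cons.inj hab).1 hkl

end SeaweedIndex

/-! ### The Lie algebra index of a seaweed subalgebra of `𝔰𝔩(n)` -/

section Link

variable {K : Type*} [Field K]

theorem mem_span_single_iff {ι : Type*} [Fintype ι] [DecidableEq ι] (P : ι → Prop) (v : ι → K) :
    v ∈ Submodule.span K {v | ∃ r : ι, P r ∧ v = Pi.single r 1} ↔ ∀ r, ¬ P r → v r = 0 := by
  constructor
  · intro hv r hr
    induction hv using Submodule.span_induction with
    | mem x hx =>
      obtain ⟨s, hs, rfl⟩ := hx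
      exact Pi.single_eq_of_ne (fun h : r = s => hr (h ▸ hs)) _
    | zero => rfl
    | add x y _ _ hx hy => rw [Pi.add_apply, hx, hy, add_zero]
    | smul c x _ hx => rw [Pi.smul_apply, hx, smul_zero]
  · intro hv
    rw [pi_eq_sum_univ' v]
    refine Submodule.sum_mem _ fun r _ => ?_
    by_cases hr : P r
    · exact Submodule.smul_mem _ _ (Submodule.subset_span ⟨r, hr, by
        ext s; simp [Pi.single_apply, eq_comm]⟩)
    · rw [hv r hr, zero_smul]
      exact zero_mem _

theorem mulVec_mem_span_single_iff {ι : Type*} [Fintype ι] [DecidableEq ι] (P : ι → Prop)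
    (x : Matrix ι ι K) :
    (∀ v ∈ Submodule.span K {v | ∃ r : ι, P r ∧ v = Pi.single r 1},
      x *ᵥ v ∈ Submodule.span K {v | ∃ r : ι, P r ∧ v = Pi.single r 1}) ↔
    ∀ r s, P s → ¬ P r → x r s = 0 := by
  simp only [mem_span_single_iff]
  constructor
  · intro h r s hs hr
    have := h (Pi.single s 1) (fun q hq => Pi.single_eq_of_ne (fun h : q = s => hq (h ▸ hs)) _) r hr
    rwa [Matrix.mulVec_single_one] at this
  · intro h v hv r hr
    refine Finset.sum_eq_zero fun s _ => ?_
    by_cases hs : P s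
    · exact mul_eq_zero_of_left (h r s hs hr) _
    · exact mul_eq_zero_of_right _ (hv s hs)

theorem separated_blocks_iff {n : ℕ} (a : Composition n) (i j : ℕ) :
    Separated a.blocks i j ↔ ∃ m ≤ a.length, i < a.sizeUpTo m ∧ a.sizeUpTo m ≤ j := by
  constructor
  · rintro ⟨m, h⟩
    rcases le_total m a.length with hm | hm
    · exact ⟨m, hm, h⟩
    · refine ⟨a.length, le_rfl, ?_⟩
      rw [List.take_of_length_le hm] at h
      rwa [Composition.sizeUpTo, List.take_of_length_le le_rfl]
  · rintro ⟨m, -, h⟩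
    exact ⟨m, h⟩

theorem mem_seaweed_iff {n : ℕ} (a b : Composition n)
    (x : LieAlgebra.SpecialLinear.sl (Fin n) K) :
    x ∈ seaweed K a b ↔
      (x : Matrix (Fin n) (Fin n) K) ∈ patternSpace K (seaweedRel a.blocks b.blocks n) := by
  have hV : ∀ i, (∀ v ∈ flagV K a i, (x : Matrix (Fin n) (Fin n) K) *ᵥ v ∈ flagV K a i) ↔ _ :=
    fun i => mulVec_mem_span_single_iff (fun r : Fin n => (r : ℕ) < a.sizeUpTo i) _
  have hW : ∀ i, (∀ v ∈ flagW K b i, (x : Matrix (Fin n) (Fin n) K) *ᵥ v ∈ flagW K b i) ↔ _ :=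
    fun i => mulVec_mem_span_single_iff (fun r : Fin n => b.sizeUpTo i ≤ (r : ℕ)) _
  change (∀ i ≤ a.length, ∀ v ∈ flagV K a i, _) ∧ (∀ j ≤ b.length, ∀ v ∈ flagW K b j, _) ↔ _
  simp only [hV, hW]
  constructor
  · rintro ⟨h1, h2⟩ r s hrs
    rw [seaweedRel, not_and_or, not_not, not_not, separated_blocks_iff, separated_blocks_iff] at hrs
    rcases hrs with ⟨m, hm, h, h'⟩ | ⟨m, hm, h, h'⟩
    · exact h1 m hm r s h (not_lt.mpr h')
    · exact h2 m hm r s h' (not_le.mpr h)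
  · intro h
    refine ⟨fun m hm r s hs hr => h r s fun hrs => hrs.1 ?_,
      fun m hm r s hs hr => h r s fun hrs => hrs.2 ?_⟩
    · exact ⟨m, hs, not_lt.mp hr⟩
    · exact ⟨m, not_le.mp hr, hs⟩

/-- The inclusion of a seaweed subalgebra of `𝔰𝔩(n)` into the space of matrices. -/
def seaweedToMatrix {n : ℕ} (a b : Composition n) :
    seaweed K a b →ₗ[K] Matrix (Fin n) (Fin n) K where
  toFun x := x.1.1
  map_add' _ _ := rfl
  map_smul' _ _ := rfl

theorem seaweedToMatrix_injective {n : ℕ} (a b : Composition n) :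
    Function.Injective (seaweedToMatrix (K := K) a b) :=
  Subtype.val_injective.comp Subtype.val_injective

theorem mem_range_seaweedToMatrix {n : ℕ} (a b : Composition n) (x : Matrix (Fin n) (Fin n) K) :
    x ∈ LinearMap.range (seaweedToMatrix (K := K) a b) ↔
      x.trace = 0 ∧ x ∈ patternSpace K (seaweedRel a.blocks b.blocks n) := by
  constructor
  · rintro ⟨y, rfl⟩
    exact ⟨LinearMap.mem_ker.mp y.1.2, (mem_seaweed_iff a b y.1).mp y.2⟩
  · rintro ⟨h1, h2⟩
    exact ⟨⟨⟨x, LinearMap.mem_ker.mpr h1⟩, (mem_seaweed_iff a b _).mpr h2⟩, rfl⟩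

theorem trace_mul_commutator {n : ℕ} (F x y : Matrix (Fin n) (Fin n) K) :
    (F * (x * y - y * x)).trace = ((F * x - x * F) * y).trace := by
  rw [mul_sub, sub_mul, Matrix.trace_sub, Matrix.trace_sub, ← Matrix.mul_assoc, ← Matrix.mul_assoc,
    Matrix.trace_mul_comm (F * y) x, Matrix.mul_assoc x F y]

/-- Passing from `𝔤𝔩(n)` to `𝔰𝔩(n)` splits off the scalar matrices from the kernel. -/
theorem finrank_ker_kirillovForm_add_one [CharZero K] {n : ℕ} (hn : 0 < n) (a b : Composition n)
    (F : Matrix (Fin n) (Fin n) K) :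
    Module.finrank K (LinearMap.ker (kirillovForm K (seaweed K a b)
      (Matrix.traceLinearMap (Fin n) K K ∘ₗ LinearMap.mulLeft K F ∘ₗ seaweedToMatrix a b))) + 1 =
    Module.finrank K (patternKer (seaweedRel a.blocks b.blocks n) F) := by
  set R := seaweedRel a.blocks b.blocks n with hR
  set f := Matrix.traceLinearMap (Fin n) K K ∘ₗ LinearMap.mulLeft K F ∘ₗ
    seaweedToMatrix (K := K) a b
  set T := Matrix.traceLinearMap (Fin n) K K
  have hn' : (n : K) ≠ 0 := Nat.cast_ne_zero.mpr hn.ne'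
  have h1R : (1 : Matrix (Fin n) (Fin n) K) ∈ patternSpace K R := fun i j hij =>
    Matrix.one_apply_ne fun h => hij (h ▸ seaweedRel_refl _ _ _ i)
  have hone : (1 : Matrix (Fin n) (Fin n) K) ∈ patternKer R F :=
    ⟨h1R, fun i j _ => by rw [mul_one, one_mul, sub_self, Matrix.zero_apply]⟩
  have hmap : (LinearMap.ker (kirillovForm K (seaweed K a b) f)).map (seaweedToMatrix a b) =
      (LinearMap.ker (T.domRestrict (patternKer R F))).map (patternKer R F).subtype := by
    ext x
    constructor
    · rintro ⟨x, hx, rfl⟩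
      obtain ⟨h1, h2⟩ := (mem_range_seaweedToMatrix a b _).mp ⟨x, rfl⟩
      set X := seaweedToMatrix a b x with hX
      refine ⟨⟨X, h2, fun i j hij => ?_⟩, h1, rfl⟩
      -- test against the projection of the matrix unit `E i j` to the traceless matrices
      let E : Matrix (Fin n) (Fin n) K := Matrix.single i j 1
      obtain ⟨y, hy⟩ : E - (E.trace / n) • (1 : Matrix (Fin n) (Fin n) K) ∈
          LinearMap.range (seaweedToMatrix (K := K) a b) := by
        rw [mem_range_seaweedToMatrix]
        constructor
        · rw [Matrix.trace_sub, Matrix.trace_smul, Matrix.trace_one, Fintype.card_fin, smul_eq_mul,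
            div_mul_cancel₀ _ hn', sub_self]
        · refine sub_mem ?_ (Submodule.smul_mem _ _ h1R)
          intro p q hpq
          refine Matrix.single_apply_of_ne _ _ _ _ _ ?_
          rintro ⟨rfl, rfl⟩
          exact hpq hij
      have h3 : (F * (X * seaweedToMatrix a b y - seaweedToMatrix a b y * X)).trace = 0 :=
        LinearMap.congr_fun (LinearMap.mem_ker.mp hx) y
      rw [trace_mul_commutator, hy, Matrix.mul_sub, Matrix.trace_sub, Matrix.mul_smul,
        Matrix.mul_one, Matrix.trace_smul, Matrix.trace_sub (F * X), Matrix.trace_mul_comm F X,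
        sub_self, smul_zero, sub_zero, Matrix.trace_mul_single, MulOpposite.op_one, one_smul] at h3
      exact h3
    · rintro ⟨⟨x, hx⟩, hx', rfl⟩
      obtain ⟨z, hz⟩ := (mem_range_seaweedToMatrix a b x).mpr ⟨hx', hx.1⟩
      refine ⟨z, LinearMap.mem_ker.mpr (LinearMap.ext fun y => ?_), hz⟩
      change (F * (seaweedToMatrix a b z * seaweedToMatrix a b y -
        seaweedToMatrix a b y * seaweedToMatrix a b z)).trace = 0
      rw [trace_mul_commutator, hz]
      refine Finset.sum_eq_zero fun j _ => ?_
      rw [Matrix.diag_apply, Matrix.mul_apply]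
      refine Finset.sum_eq_zero fun i _ => ?_
      by_cases hij : R i j
      · rw [hx.2 i j hij, zero_mul]
      · rw [((mem_range_seaweedToMatrix a b _).mp ⟨y, rfl⟩).2 i j hij, mul_zero]
  have hfin : Module.finrank K (LinearMap.ker (kirillovForm K (seaweed K a b) f)) =
      Module.finrank K (LinearMap.ker (T.domRestrict (patternKer R F))) := by
    rw [← Submodule.finrank_map_subtype_eq (patternKer R F), ← hmap]
    exact LinearEquiv.finrank_eq
      (Submodule.equivMapOfInjective _ (seaweedToMatrix_injective a b) _)
  have hrange : LinearMap.range (T.domRestrict (patternKer R F)) = ⊤ := by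
    refine LinearMap.range_eq_top.mpr fun c => ⟨(c / n) • ⟨1, hone⟩, ?_⟩
    rw [map_smul]
    change (c / n) • (1 : Matrix (Fin n) (Fin n) K).trace = c
    rw [Matrix.trace_one, Fintype.card_fin, smul_eq_mul, div_mul_cancel₀ _ hn']
  have := LinearMap.finrank_range_add_finrank_ker (T.domRestrict (patternKer R F))
  rw [hrange, finrank_top, Module.finrank_self] at this
  rw [hfin]
  omega

/-- Every linear form on the algebra is `x ↦ tr (F x)` for some matrix `F`. -/
theorem exists_eq_trace_mul {n : ℕ} (a b : Composition n) (f : Module.Dual K (seaweed K a b)) :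
    ∃ F : Matrix (Fin n) (Fin n) K, f =
      Matrix.traceLinearMap (Fin n) K K ∘ₗ LinearMap.mulLeft K F ∘ₗ seaweedToMatrix a b := by
  obtain ⟨P, hP⟩ := (seaweedToMatrix (K := K) a b).exists_leftInverse_of_injective
    (LinearMap.ker_eq_bot.mpr (seaweedToMatrix_injective a b))
  refine ⟨Matrix.of fun j i => f (P (Matrix.single i j 1)), LinearMap.ext fun x => ?_⟩
  have h1 : f x = f (P (seaweedToMatrix a b x)) := by
    rw [show P (seaweedToMatrix a b x) = x from LinearMap.congr_fun hP x]
  rw [h1]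
  set X := seaweedToMatrix a b x with hX
  change _ = Matrix.trace (_ * X)
  have h2 : f (P X) = ∑ i, ∑ j, X i j * f (P (Matrix.single i j 1)) := by
    conv_lhs => rw [Matrix.matrix_eq_sum_single X]
    rw [map_sum, map_sum]
    refine Finset.sum_congr rfl fun i _ => ?_
    rw [map_sum, map_sum]
    refine Finset.sum_congr rfl fun j _ => ?_
    rw [← smul_eq_mul, ← map_smul, ← map_smul, Matrix.smul_single, smul_eq_mul, mul_one]
  rw [h2, Finset.sum_comm, Matrix.trace]
  refine Finset.sum_congr rfl fun j _ => ?_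
  rw [Matrix.diag_apply, Matrix.mul_apply]
  exact Finset.sum_congr rfl fun i _ => mul_comm _ _

theorem lieIndex_seaweed_add_one [CharZero K] {n : ℕ} (hn : 0 < n) (a b : Composition n) :
    lieIndex K (seaweed K a b) + 1 = seaweedIndex K a.blocks b.blocks n := by
  apply le_antisymm
  · refine le_patternIndex fun F => ?_
    rw [← finrank_ker_kirillovForm_add_one hn]
    exact Nat.add_le_add_right (ciInf_le (OrderBot.bddBelow _) _) 1
  · obtain ⟨f, hf⟩ := ciInf_mem fun f : Module.Dual K (seaweed K a b) =>
      Module.finrank K (LinearMap.ker (kirillovForm K (seaweed K a b) f))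
    obtain ⟨F, rfl⟩ := exists_eq_trace_mul a b f
    rw [lieIndex, ← hf, finrank_ker_kirillovForm_add_one hn]
    exact patternIndex_le _ _

theorem lieIndex_seaweed_eq_sub_three_iff [CharZero K] {n : ℕ} (hn : 3 ≤ n) (a b : Composition n) :
    lieIndex K (seaweed K a b) = n - 3 ↔ seaweedDefect K a.blocks b.blocks = 2 := by
  have h := lieIndex_seaweed_add_one (K := K) (by omega) a b
  rw [seaweedDefect, a.blocks_sum]
  omega

end Link

/-! ### Counting pairs of compositions by their defect -/

section Count

/-- The compositions of `n`, as lists of positive integers. -/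
def compositionLists (n : ℕ) : Finset (List ℕ) :=
  (Finset.univ : Finset (Composition n)).map ⟨Composition.blocks, fun _ _ => Composition.ext⟩

theorem mem_compositionLists {n : ℕ} {a : List ℕ} :
    a ∈ compositionLists n ↔ (∀ k ∈ a, 0 < k) ∧ a.sum = n := by
  rw [compositionLists, Finset.mem_map]
  constructor
  · rintro ⟨c, -, rfl⟩
    exact ⟨fun k hk => c.blocks_pos hk, c.blocks_sum⟩
  · rintro ⟨h1, h2⟩
    exact ⟨⟨a, fun {k} hk => h1 k hk, h2⟩, Finset.mem_univ _, rfl⟩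

theorem cons_mem_compositionLists {n k : ℕ} {a : List ℕ} (hk : 0 < k)
    (ha : a ∈ compositionLists n) : k :: a ∈ compositionLists (k + n) := by
  rw [mem_compositionLists] at ha ⊢
  refine ⟨fun l hl => ?_, by rw [List.sum_cons, ha.2]⟩
  rcases List.mem_cons.mp hl with rfl | hl
  · exact hk
  · exact ha.1 l hl

theorem card_compositionLists (n : ℕ) : (compositionLists n).card = 2 ^ (n - 1) := by
  rw [compositionLists, Finset.card_map, Finset.card_univ, composition_card]

theorem compositionLists_zero : compositionLists 0 = {[]} := by
  ext a
  rw [mem_compositionLists, Finset.mem_singleton]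
  constructor
  · rintro ⟨h1, h2⟩
    rcases a with _ | ⟨k, a⟩
    · rfl
    · have := h1 k (by simp)
      rw [List.sum_cons] at h2
      omega
  · rintro rfl
    simp

theorem sum_card_compositionLists (n : ℕ) :
    ∑ j ∈ Finset.range (n + 1), (compositionLists j).card = 2 ^ n := by
  induction n with
  | zero => simp [card_compositionLists]
  | succ n ih =>
    rw [Finset.sum_range_succ, ih, card_compositionLists, Nat.add_sub_cancel, pow_succ, mul_two]

/-- Summation over compositions, by the first part. -/
theorem sum_compositionLists_succ (n : ℕ) (f : List ℕ → ℕ) :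
    ∑ a ∈ compositionLists (n + 1), f a =
      ∑ i ∈ Finset.range (n + 1), ∑ a ∈ compositionLists (n - i), f ((i + 1) :: a) := by
  rw [Finset.sum_sigma']
  symm
  refine Finset.sum_bij (fun x _ => (x.1 + 1) :: x.2) ?_ ?_ ?_ fun _ _ => rfl
  · rintro ⟨i, a⟩ h
    obtain ⟨hi, ha⟩ := Finset.mem_sigma.mp h
    have hi' : i < n + 1 := Finset.mem_range.mp hi
    have := cons_mem_compositionLists (Nat.succ_pos i) ha
    rwa [show i.succ + (n - i) = n + 1 by omega] at this
  · rintro ⟨i, a⟩ - ⟨j, b⟩ - h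
    obtain ⟨h1, rfl⟩ := List.cons.inj h
    obtain rfl : i = j := Nat.succ_injective h1
    rfl
  · intro a ha
    rw [mem_compositionLists] at ha
    rcases a with _ | ⟨k, a⟩
    · exact absurd ha.2 (by simp)
    have hk := ha.1 k (by simp)
    rw [List.sum_cons] at ha
    have h1 : k - 1 < n + 1 := by omega
    have h2 : a.sum = n - (k - 1) := by omega
    refine ⟨⟨k - 1, a⟩, Finset.mem_sigma.mpr ⟨Finset.mem_range.mpr h1,
      mem_compositionLists.mpr ⟨fun l hl => ha.1 l (List.mem_cons_of_mem _ hl), h2⟩⟩, ?_⟩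
    change (k - 1 + 1) :: a = k :: a
    rw [Nat.sub_add_cancel hk]

theorem sum_range_sum_range_of_symm (n : ℕ) (g : ℕ → ℕ → ℕ) (hg : ∀ i j, g i j = g j i) :
    ∑ i ∈ Finset.range n, ∑ j ∈ Finset.range n, g i j =
      ∑ i ∈ Finset.range n, g i i +
        2 * ∑ i ∈ Finset.range n, ∑ j ∈ Finset.Ico (i + 1) n, g i j := by
  induction n with
  | zero => simp
  | succ n ih =>
    have h1 : ∀ i ∈ Finset.range n, ∑ j ∈ Finset.Ico (i + 1) (n + 1), g i j =
        ∑ j ∈ Finset.Ico (i + 1) n, g i j + g i n := fun i hi =>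
      Finset.sum_Ico_succ_top (Finset.mem_range.mp hi) _
    simp only [Finset.sum_range_succ, Finset.sum_add_distrib, Finset.sum_congr rfl h1, ih,
      Finset.Ico_self, Finset.sum_empty, hg n]
    ring

theorem sum_Ico_one_reflect (n : ℕ) (f : ℕ → ℕ) :
    ∑ j ∈ Finset.Ico 1 (n + 1), f (n - j) = ∑ j ∈ Finset.range n, f j := by
  rw [Finset.sum_Ico_eq_sum_range, Nat.add_sub_cancel, ← Finset.sum_range_reflect f]
  exact Finset.sum_congr rfl fun j _ => by rw [Nat.sub_sub]

variable (K : Type*) [Field K]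

/-- The indicator of the pairs of defect `d`. -/
noncomputable def defectIndicator (d : ℕ) (a b : List ℕ) : ℕ :=
  if seaweedDefect K a b = d then 1 else 0

/-- The number of pairs of compositions of `n` of defect `d`. -/
noncomputable def defectCount (d n : ℕ) : ℕ :=
  ∑ a ∈ compositionLists n, ∑ b ∈ compositionLists n, defectIndicator K d a b

/-- The number of pairs of compositions of `n + 1` and defect `d`, of which the first has first part
`i + 1` and the second has first part `j + 1`. -/
noncomputable def headCount (d n i j : ℕ) : ℕ :=
  ∑ a ∈ compositionLists (n - i), ∑ b ∈ compositionLists (n - j),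
    defectIndicator K d ((i + 1) :: a) ((j + 1) :: b)

variable {K}

theorem defectIndicator_congr {d d' : ℕ} {a b a' b' : List ℕ}
    (h : seaweedDefect K a b = d ↔ seaweedDefect K a' b' = d') :
    defectIndicator K d a b = defectIndicator K d' a' b' := by
  rw [defectIndicator, defectIndicator]
  simp only [h]

theorem defectIndicator_of_ne {d : ℕ} {a b : List ℕ} (h : seaweedDefect K a b ≠ d) :
    defectIndicator K d a b = 0 := if_neg h

theorem sum_cons_eq_of_mem {n i : ℕ} (hi : i ≤ n) {a : List ℕ}
    (ha : a ∈ compositionLists (n - i)) : ((i + 1) :: a).sum = n + 1 := by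
  rw [List.sum_cons, (mem_compositionLists.mp ha).2]
  omega

theorem headCount_comm {d n i j : ℕ} (hi : i ≤ n) (hj : j ≤ n) :
    headCount K d n i j = headCount K d n j i := by
  rw [headCount, Finset.sum_comm]
  refine Finset.sum_congr rfl fun b hb => Finset.sum_congr rfl fun a ha =>
    defectIndicator_congr ?_
  rw [seaweedDefect_comm]
  rw [sum_cons_eq_of_mem hi ha, sum_cons_eq_of_mem hj hb]

theorem defectCount_zero_right (d : ℕ) : defectCount K (d + 1) 0 = 0 := by
  rw [defectCount, compositionLists_zero, Finset.sum_singleton, Finset.sum_singleton]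
  exact defectIndicator_of_ne (by rw [seaweedDefect_nil]; omega)

variable [Infinite K]

theorem headCount_self (d n i : ℕ) : headCount K d n i i = defectCount K d (n - i) :=
  Finset.sum_congr rfl fun _ _ => Finset.sum_congr rfl fun _ _ => defectIndicator_congr (by
    rw [seaweedDefect_cons_cons_self])

theorem headCount_eq_zero {d n i j : ℕ} (hi : i ≤ n) (hj : j ≤ n) (hij : i < j) (hd : d ≤ i) :
    headCount K d n i j = 0 := by
  refine Finset.sum_eq_zero fun a ha => Finset.sum_eq_zero fun b hb => defectIndicator_of_ne ?_
  have := le_seaweedDefect_cons_cons K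
    ((sum_cons_eq_of_mem hi ha).trans (sum_cons_eq_of_mem hj hb).symm) (Nat.succ_lt_succ hij)
  omega

/-- Equal first parts can be removed, and different ones are counted up to symmetry. -/
theorem defectCount_succ (d n : ℕ) : defectCount K d (n + 1) =
    ∑ i ∈ Finset.range (n + 1), defectCount K d i +
      2 * ∑ i ∈ Finset.range (n + 1), ∑ j ∈ Finset.Ico (i + 1) (n + 1), headCount K d n i j := by
  have h1 : defectCount K d (n + 1) =
      ∑ i ∈ Finset.range (n + 1), ∑ j ∈ Finset.range (n + 1), headCount K d n i j := by
    rw [defectCount, sum_compositionLists_succ]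
    refine Finset.sum_congr rfl fun i _ => ?_
    rw [Finset.sum_congr rfl fun a _ => sum_compositionLists_succ n
      (fun b => defectIndicator K d ((i + 1) :: a) b), Finset.sum_comm]
    exact Finset.sum_congr rfl fun j _ => by rw [headCount]
  have h2 : ∑ i ∈ Finset.range (n + 1), ∑ j ∈ Finset.range (n + 1), headCount K d n i j =
      ∑ i ∈ Finset.range (n + 1), ∑ j ∈ Finset.range (n + 1),
        headCount K d n (min i n) (min j n) := by
    refine Finset.sum_congr rfl fun i hi => Finset.sum_congr rfl fun j hj => ?_
    rw [Finset.mem_range] at hi hj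
    rw [min_eq_left (by omega), min_eq_left (by omega)]
  rw [h1, h2, sum_range_sum_range_of_symm (n + 1)
    (fun i j => headCount K d n (min i n) (min j n)) fun i j =>
      headCount_comm (min_le_right _ _) (min_le_right _ _),
    ← Finset.sum_range_reflect (fun i => defectCount K d i) (n + 1)]
  refine congrArg₂ (· + ·) ?_ (congrArg (2 * ·) ?_)
  · refine Finset.sum_congr rfl fun i hi => ?_
    rw [headCount_self, min_eq_left (by rw [Finset.mem_range] at hi; omega), Nat.add_sub_cancel]
  · refine Finset.sum_congr rfl fun i hi => Finset.sum_congr rfl fun j hj => ?_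
    rw [Finset.mem_range] at hi
    rw [Finset.mem_Ico] at hj
    rw [min_eq_left (by omega), min_eq_left (by omega)]

/-- A pair of defect `0` consists of equal compositions; here `l` may be zero. -/
theorem sum_defectIndicator_zero {l n : ℕ} {x : List ℕ} (hx : ∀ k ∈ x, 0 < k)
    (h : l + x.sum = n) : ∑ a ∈ compositionLists n, defectIndicator K 0 a (l :: x) = 1 := by
  obtain ⟨y, hy, hyn⟩ : ∃ y ∈ compositionLists n, ∀ a, seaweedDefect K a (l :: x) =
      seaweedDefect K a y := by
    rcases Nat.eq_zero_or_pos l with rfl | hl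
    · exact ⟨x, mem_compositionLists.mpr ⟨hx, by omega⟩, fun a =>
        seaweedDefect_zero_cons_right K a x⟩
    · refine ⟨l :: x, ?_, fun _ => rfl⟩
      rw [← h]
      exact cons_mem_compositionLists hl (mem_compositionLists.mpr ⟨hx, rfl⟩)
  rw [Finset.sum_eq_single y]
  · rw [defectIndicator, hyn, if_pos]
    have := mem_compositionLists.mp hy
    exact (seaweedDefect_eq_zero_iff K this.1 this.1 rfl).mpr rfl
  · intro a ha hay
    refine defectIndicator_of_ne fun h0 => hay ?_
    have h1 := mem_compositionLists.mp hy
    have h2 := mem_compositionLists.mp ha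
    rw [hyn] at h0
    exact (seaweedDefect_eq_zero_iff K h2.1 h1.1 (h2.2.trans h1.2.symm)).mp h0
  · exact fun h => absurd hy h

/-- If the first part `k` of the first composition is at most half of that of the second, then
the pairs of minimal defect `k` are determined by the second composition. -/
theorem sum_defectIndicator_cons {k l n : ℕ} (hk : 0 < k) {x : List ℕ} (hx : ∀ k ∈ x, 0 < k)
    (hkl : 2 * k ≤ l) (h : k + n = l + x.sum) :
    ∑ a ∈ compositionLists n, defectIndicator K k (k :: a) (l :: x) = 1 := by
  have hx' : ∀ i ∈ k :: x, 0 < i := by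
    intro i hi
    rcases List.mem_cons.mp hi with rfl | hi
    · exact hk
    · exact hx i hi
  rw [← sum_defectIndicator_zero (K := K) (l := l - 2 * k) hx'
    (n := n) (by rw [List.sum_cons]; omega)]
  refine Finset.sum_congr rfl fun a ha => defectIndicator_congr ?_
  rw [seaweedDefect_cons_cons_of_two_mul_le K (by
    rw [List.sum_cons, List.sum_cons, (mem_compositionLists.mp ha).2, h]) hkl]
  omega

theorem headCount_one_zero {n j : ℕ} (hj : 1 ≤ j) (hjn : j ≤ n) :
    headCount K 1 n 0 j = (compositionLists (n - j)).card := by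
  rw [headCount, Finset.sum_comm, Finset.card_eq_sum_ones]
  refine Finset.sum_congr rfl fun b hb => ?_
  obtain ⟨hb1, hb2⟩ := mem_compositionLists.mp hb
  exact sum_defectIndicator_cons one_pos hb1 (by omega) (by omega)

theorem defectCount_one_succ (n : ℕ) : defectCount K 1 (n + 1) =
    ∑ i ∈ Finset.range (n + 1), defectCount K 1 i +
      2 * ∑ j ∈ Finset.range n, (compositionLists j).card := by
  rw [defectCount_succ, Finset.sum_range_succ'
    (fun i => ∑ j ∈ Finset.Ico (i + 1) (n + 1), headCount K 1 n i j),
    Finset.sum_eq_zero (s := Finset.range n), zero_add,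
    ← sum_Ico_one_reflect n fun j => (compositionLists j).card]
  · congr 2
    refine Finset.sum_congr rfl fun j hj => ?_
    rw [Finset.mem_Ico] at hj
    exact headCount_one_zero hj.1 (by omega)
  · intro i hi
    refine Finset.sum_eq_zero fun j hj => ?_
    rw [Finset.mem_range] at hi
    rw [Finset.mem_Ico] at hj
    exact headCount_eq_zero (by omega) (by omega) (by omega) (by omega)

theorem defectCount_one_one : defectCount K 1 1 = 0 := by
  rw [defectCount_one_succ]
  simp [defectCount_zero_right]

theorem sum_defectCount_one (n : ℕ) :
    ∑ i ∈ Finset.range (n + 2), defectCount K 1 i = n * 2 ^ n := by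
  induction n with
  | zero => simp [Finset.sum_range_succ, defectCount_zero_right, defectCount_one_one]
  | succ n ih =>
    rw [Finset.sum_range_succ, defectCount_one_succ, ih, sum_card_compositionLists]
    ring

theorem defectCount_one_add_two (n : ℕ) : defectCount K 1 (n + 2) = (n + 2) * 2 ^ n := by
  rw [defectCount_one_succ, sum_defectCount_one, sum_card_compositionLists]
  ring

end Count

/-! ### Pairs of defect two -/

section CountTwo

variable (K : Type*) [Field K]

/-- The number of pairs of a composition `a` of `n + 1` and a composition `b` of `n` such that the
pair `a`, `(1, b)` has defect `1`. -/
noncomputable def oneConsCount (n : ℕ) : ℕ :=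
  ∑ a ∈ compositionLists (n + 1), ∑ b ∈ compositionLists n, defectIndicator K 1 a (1 :: b)

/-- The number of pairs of a composition `a` of `p + 1`, with first part `i + 1`, and a composition
`b` of `p - l` such that the pair `a`, `(l, 1, b)` has defect `1`. -/
noncomputable def consOneConsCount (p l i : ℕ) : ℕ :=
  ∑ a ∈ compositionLists (p - i), ∑ b ∈ compositionLists (p - l),
    defectIndicator K 1 ((i + 1) :: a) (l :: 1 :: b)

variable {K} [Infinite K]

theorem one_cons_pos {x : List ℕ} (hx : ∀ k ∈ x, 0 < k) : ∀ k ∈ 1 :: x, 0 < k := by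
  intro k hk
  rcases List.mem_cons.mp hk with rfl | hk
  · exact one_pos
  · exact hx k hk

theorem oneConsCount_eq (n : ℕ) : oneConsCount K n =
    defectCount K 1 n + ∑ j ∈ Finset.range n, (compositionLists j).card := by
  rw [oneConsCount, sum_compositionLists_succ, Finset.sum_range_succ', add_comm]
  congr 1
  · exact Finset.sum_congr rfl fun a _ => Finset.sum_congr rfl fun b _ =>
      defectIndicator_congr (by rw [seaweedDefect_cons_cons_self])
  · rw [← Finset.sum_range_reflect (fun j => (compositionLists j).card)]
    refine Finset.sum_congr rfl fun i hi => ?_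
    rw [Finset.mem_range] at hi
    rw [Finset.card_eq_sum_ones, Nat.sub_sub, add_comm 1 i]
    refine Finset.sum_congr rfl fun a ha => ?_
    obtain ⟨ha1, ha2⟩ := mem_compositionLists.mp ha
    refine Eq.trans ?_ (sum_defectIndicator_cons (K := K) (k := 1) (l := i + 1 + 1) (n := n)
      one_pos ha1 (by omega) (by omega))
    refine Finset.sum_congr rfl fun b hb => defectIndicator_congr ?_
    rw [seaweedDefect_comm]
    simp only [List.sum_cons, ha2, (mem_compositionLists.mp hb).2]
    omega

theorem headCount_two_zero {p j : ℕ} (hj : 1 ≤ j) (hjp : j ≤ p + 1) : headCount K 2 (p + 1) 0 j =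
    ∑ a ∈ compositionLists (p + 1), ∑ b ∈ compositionLists (p + 1 - j),
      defectIndicator K 1 a ((j - 1) :: 1 :: b) := by
  refine Finset.sum_congr rfl fun a ha => Finset.sum_congr rfl fun b hb =>
    defectIndicator_congr ?_
  rw [seaweedDefect_cons_cons_of_two_mul_le K ((sum_cons_eq_of_mem (Nat.zero_le _) ha).trans
    (sum_cons_eq_of_mem hjp hb).symm) (by omega), show j + 1 - 2 * (0 + 1) = j - 1 by omega]
  simp only [zero_add]
  omega

theorem headCount_two_zero_one (p : ℕ) : headCount K 2 (p + 1) 0 1 = oneConsCount K p := by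
  rw [headCount_two_zero le_rfl (by omega)]
  exact Finset.sum_congr rfl fun a _ => Finset.sum_congr rfl fun b _ =>
    defectIndicator_congr (by rw [Nat.sub_self, seaweedDefect_zero_cons_right])

theorem headCount_two_zero_succ {p l : ℕ} (hl : 1 ≤ l) (hlp : l ≤ p) :
    headCount K 2 (p + 1) 0 (l + 1) = ∑ i ∈ Finset.range (p + 1), consOneConsCount K p l i := by
  rw [headCount_two_zero (by omega) (by omega), sum_compositionLists_succ, Nat.add_sub_cancel,
    Nat.add_sub_add_right]
  rfl

theorem consOneConsCount_same {p l : ℕ} (hl : 1 ≤ l) (hlp : l ≤ p) :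
    consOneConsCount K p l (l - 1) = oneConsCount K (p - l) := by
  rw [consOneConsCount, oneConsCount, Nat.sub_add_cancel hl, show p - (l - 1) = p - l + 1 by omega]
  exact Finset.sum_congr rfl fun a _ => Finset.sum_congr rfl fun b _ =>
    defectIndicator_congr (by rw [seaweedDefect_cons_cons_self])

theorem consOneConsCount_zero {p l : ℕ} (hl : 2 ≤ l) (hlp : l ≤ p) :
    consOneConsCount K p l 0 = (compositionLists (p - l)).card := by
  rw [consOneConsCount, Finset.sum_comm, Finset.card_eq_sum_ones]
  refine Finset.sum_congr rfl fun b hb => ?_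
  obtain ⟨hb1, hb2⟩ := mem_compositionLists.mp hb
  exact sum_defectIndicator_cons one_pos (one_cons_pos hb1) (by omega)
    (by rw [List.sum_cons]; omega)

theorem consOneConsCount_eq_zero {p l i : ℕ} (hl : 2 ≤ l) (hlp : l ≤ p) (hi : 1 ≤ i) (hip : i ≤ p)
    (hil : i + 1 ≠ l) : consOneConsCount K p l i = 0 := by
  refine Finset.sum_eq_zero fun a ha => Finset.sum_eq_zero fun b hb => defectIndicator_of_ne ?_
  have := min_le_seaweedDefect_cons_cons K (a := a) (b := 1 :: b) (k := i + 1) (l := l) (by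
    simp only [List.sum_cons, (mem_compositionLists.mp ha).2, (mem_compositionLists.mp hb).2]
    omega) hil
  have : 2 ≤ min (i + 1) l := le_min (by omega) hl
  omega

theorem seaweedDefect_cons_one_one_cons {p i : ℕ} (hi : 1 ≤ i) (hip : i ≤ p) {a b : List ℕ}
    (ha : a ∈ compositionLists (p - i)) (hb : b ∈ compositionLists (p - 1)) :
    seaweedDefect K ((i + 1) :: a) (1 :: 1 :: b) = 1 ↔
      seaweedDefect K (1 :: b) ((i - 1) :: 1 :: a) = 0 := by
  have hs : ((i + 1) :: a).sum = (1 :: 1 :: b).sum := by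
    simp only [List.sum_cons, (mem_compositionLists.mp ha).2, (mem_compositionLists.mp hb).2]
    omega
  rw [seaweedDefect_comm K hs, seaweedDefect_cons_cons_of_two_mul_le K hs.symm (by omega),
    show i + 1 - 2 * 1 = i - 1 by omega]
  omega

theorem consOneConsCount_one_one {p : ℕ} (hp : 1 ≤ p) :
    consOneConsCount K p 1 1 = (compositionLists (p - 1)).card := by
  rw [consOneConsCount, Finset.card_eq_sum_ones]
  refine Finset.sum_congr rfl fun a ha => ?_
  obtain ⟨ha1, ha2⟩ := mem_compositionLists.mp ha
  refine Eq.trans ?_ (sum_defectIndicator_zero (K := K) (l := 0) (n := p - 1) ha1 (by omega))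
  refine Finset.sum_congr rfl fun b hb => defectIndicator_congr ?_
  rw [seaweedDefect_cons_one_one_cons le_rfl hp ha hb, Nat.sub_self, seaweedDefect_zero_cons_right,
    seaweedDefect_zero_cons_right, seaweedDefect_cons_cons_self]

theorem consOneConsCount_one_two {p : ℕ} (hp : 2 ≤ p) :
    consOneConsCount K p 1 2 = (compositionLists (p - 2)).card := by
  rw [consOneConsCount, Finset.card_eq_sum_ones]
  refine Finset.sum_congr rfl fun a ha => ?_
  obtain ⟨ha1, ha2⟩ := mem_compositionLists.mp ha
  refine Eq.trans ?_ (sum_defectIndicator_zero (K := K) (l := 1) (n := p - 1) ha1 (by omega))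
  refine Finset.sum_congr rfl fun b hb => defectIndicator_congr ?_
  rw [seaweedDefect_cons_one_one_cons (by omega) hp ha hb, seaweedDefect_cons_cons_self]

theorem consOneConsCount_one_eq_zero {p i : ℕ} (hi : 3 ≤ i) (hip : i ≤ p) :
    consOneConsCount K p 1 i = 0 := by
  refine Finset.sum_eq_zero fun a ha => Finset.sum_eq_zero fun b hb => defectIndicator_of_ne ?_
  rw [Ne, seaweedDefect_cons_one_one_cons (by omega) hip ha hb]
  have hs : (1 :: b).sum = ((i - 1) :: 1 :: a).sum := by
    simp only [List.sum_cons, (mem_compositionLists.mp ha).2, (mem_compositionLists.mp hb).2]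
    omega
  have := le_seaweedDefect_cons_cons K hs (by omega)
  omega

theorem sum_consOneConsCount_one {p : ℕ} (hp : 1 ≤ p) :
    ∑ i ∈ Finset.range (p + 1), consOneConsCount K p 1 i = oneConsCount K (p - 1) +
      (compositionLists (p - 1)).card + if 2 ≤ p then (compositionLists (p - 2)).card else 0 := by
  obtain ⟨q, rfl⟩ := Nat.exists_eq_add_of_le' hp
  have h0 := consOneConsCount_same (K := K) le_rfl hp
  rw [Nat.sub_self] at h0
  rw [Finset.sum_range_succ', Finset.sum_range_succ', h0, consOneConsCount_one_one hp]
  rcases q with _ | q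
  · simp [add_comm]
  · rw [Finset.sum_range_succ', consOneConsCount_one_two (by omega), Finset.sum_eq_zero,
      if_pos (by omega)]
    · omega
    · intro i hi
      rw [Finset.mem_range] at hi
      exact consOneConsCount_one_eq_zero (by omega) (by omega)

theorem sum_consOneConsCount {p l : ℕ} (hl : 2 ≤ l) (hlp : l ≤ p) :
    ∑ i ∈ Finset.range (p + 1), consOneConsCount K p l i =
      oneConsCount K (p - l) + (compositionLists (p - l)).card := by
  rw [Finset.sum_eq_add (l - 1) 0 (by omega), consOneConsCount_same (by omega) hlp,
    consOneConsCount_zero hl hlp]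
  · rintro i hi ⟨h1, h2⟩
    rw [Finset.mem_range] at hi
    exact consOneConsCount_eq_zero hl hlp (by omega) (by omega) (by omega)
  · exact fun h => absurd (Finset.mem_range.mpr (by omega)) h
  · exact fun h => absurd (Finset.mem_range.mpr (by omega)) h

theorem headCount_two_one {p j : ℕ} (hj : 2 ≤ j) (hjp : j ≤ p + 1) :
    headCount K 2 (p + 1) 1 j = (compositionLists (p + 1 - j)).card := by
  rw [headCount, Finset.sum_comm, Finset.card_eq_sum_ones]
  refine Finset.sum_congr rfl fun b hb => ?_
  obtain ⟨hb1, hb2⟩ := mem_compositionLists.mp hb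
  rcases hj.eq_or_lt with rfl | hj'
  · refine Eq.trans ?_ (sum_defectIndicator_cons (K := K) (k := 1) (l := 2) (n := p + 1 - 1)
      one_pos hb1 le_rfl (by omega))
    refine Finset.sum_congr rfl fun a ha => defectIndicator_congr ?_
    rw [seaweedDefect_cons_cons_of_le_two_mul K ((sum_cons_eq_of_mem (by omega) ha).trans
      (sum_cons_eq_of_mem hjp hb).symm) (by omega) (by omega)]
    change 1 + seaweedDefect K (1 :: a) (2 :: b) = 2 ↔ _
    omega
  · exact sum_defectIndicator_cons two_pos hb1 (by omega) (by omega)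

/-- In a pair with different first parts, the smaller one is `1` or `2`. If it is `1`, one reduction
leads to the pairs of defect `1` counted by `oneConsCount` and `consOneConsCount`; if it is `2`, the
pair is determined by the composition with the larger first part. -/
theorem defectCount_two_add_two (p : ℕ) : defectCount K 2 (p + 2) =
    ∑ i ∈ Finset.range (p + 2), defectCount K 2 i +
      2 * (∑ q ∈ Finset.range (p + 1), oneConsCount K q +
        2 * ∑ q ∈ Finset.range p, (compositionLists q).card +
        if 2 ≤ p then (compositionLists (p - 2)).card else 0) := by
  have h0 : ∑ j ∈ Finset.Ico 1 (p + 1 + 1), headCount K 2 (p + 1) 0 j =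
      ∑ q ∈ Finset.range (p + 1), oneConsCount K q +
        ∑ q ∈ Finset.range p, (compositionLists q).card +
        if 2 ≤ p then (compositionLists (p - 2)).card else 0 := by
    have hsum : ∑ l ∈ Finset.Ico 1 (p + 1), headCount K 2 (p + 1) 0 (l + 1) =
        ∑ l ∈ Finset.Ico 1 (p + 1), (oneConsCount K (p - l) + (compositionLists (p - l)).card) +
        if 2 ≤ p then (compositionLists (p - 2)).card else 0 := by
      rcases Nat.eq_zero_or_pos p with rfl | hp
      · simp
      · rw [Finset.sum_eq_sum_Ico_succ_bot (by omega) (fun l => headCount K 2 (p + 1) 0 (l + 1)),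
          Finset.sum_eq_sum_Ico_succ_bot (by omega)
            (fun l => oneConsCount K (p - l) + (compositionLists (p - l)).card),
          headCount_two_zero_succ le_rfl hp, sum_consOneConsCount_one hp]
        have : ∀ l ∈ Finset.Ico (1 + 1) (p + 1), headCount K 2 (p + 1) 0 (l + 1) =
            oneConsCount K (p - l) + (compositionLists (p - l)).card := by
          intro l hl
          rw [Finset.mem_Ico] at hl
          rw [headCount_two_zero_succ (by omega) (by omega),
            sum_consOneConsCount (by omega) (by omega)]
        rw [Finset.sum_congr rfl this]
        omega
    rw [sum_Ico_one_reflect p fun q => oneConsCount K q + (compositionLists q).card] at hsum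
    rw [Finset.sum_eq_sum_Ico_succ_bot (by omega), headCount_two_zero_one,
      ← Finset.sum_Ico_add' (fun j => headCount K 2 (p + 1) 0 j) 1 (p + 1) 1, hsum,
      Finset.sum_add_distrib, Finset.sum_range_succ (fun q => oneConsCount K q)]
    omega
  have h1 : ∑ j ∈ Finset.Ico (1 + 1) (p + 1 + 1), headCount K 2 (p + 1) 1 j =
      ∑ q ∈ Finset.range p, (compositionLists q).card := by
    rw [← sum_Ico_one_reflect p fun q => (compositionLists q).card,
      ← Finset.sum_Ico_add' (fun j => headCount K 2 (p + 1) 1 j) 1 (p + 1) 1]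
    refine Finset.sum_congr rfl fun j hj => ?_
    rw [Finset.mem_Ico] at hj
    rw [headCount_two_one (by omega) (by omega), Nat.add_sub_add_right]
  rw [defectCount_succ, Finset.sum_range_succ'
    (fun i => ∑ j ∈ Finset.Ico (i + 1) (p + 1 + 1), headCount K 2 (p + 1) i j),
    Finset.sum_range_succ'
    (fun i => ∑ j ∈ Finset.Ico (i + 1 + 1) (p + 1 + 1), headCount K 2 (p + 1) (i + 1) j),
    Finset.sum_eq_zero (s := Finset.range p)]
  · simp only [zero_add] at h0 h1 ⊢
    rw [h0, h1]
    ring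
  · intro i hi
    refine Finset.sum_eq_zero fun j hj => ?_
    rw [Finset.mem_range] at hi
    rw [Finset.mem_Ico] at hj
    exact headCount_eq_zero (by omega) (by omega) (by omega) (by omega)

theorem defectCount_two_one : defectCount K 2 1 = 0 := by
  rw [defectCount_succ]
  simp [defectCount_zero_right]

theorem oneConsCount_zero : oneConsCount K 0 = 0 := by
  rw [oneConsCount_eq]
  simp [defectCount_zero_right]

theorem oneConsCount_one : oneConsCount K 1 = 1 := by
  rw [oneConsCount_eq]
  simp [defectCount_one_one, card_compositionLists]

theorem oneConsCount_add_two (n : ℕ) : oneConsCount K (n + 2) = (n + 4) * 2 ^ n := by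
  rw [oneConsCount_eq, defectCount_one_add_two, sum_card_compositionLists]
  ring

theorem sum_oneConsCount (n : ℕ) :
    ∑ q ∈ Finset.range (n + 2), oneConsCount K q + 1 = (n + 2) * 2 ^ n := by
  induction n with
  | zero => simp [Finset.sum_range_succ, oneConsCount_zero, oneConsCount_one]
  | succ n ih =>
    rw [Finset.sum_range_succ, add_right_comm, ih, oneConsCount_add_two]
    ring

theorem defectCount_two_two : defectCount K 2 2 = 0 := by
  rw [defectCount_two_add_two]
  simp [Finset.sum_range_succ, defectCount_zero_right, defectCount_two_one, oneConsCount_zero]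

theorem defectCount_two_three : defectCount K 2 3 = 6 := by
  rw [defectCount_two_add_two]
  simp [Finset.sum_range_succ, defectCount_zero_right, defectCount_two_one, defectCount_two_two,
    oneConsCount_zero, oneConsCount_one, card_compositionLists]

theorem defectCount_two_add_four (r : ℕ) : defectCount K 2 (r + 4) + 2 =
    ∑ i ∈ Finset.range (r + 4), defectCount K 2 i + 2 * ((2 * r + 10) * 2 ^ r + 2 ^ (r - 1)) := by
  have h := sum_oneConsCount (K := K) (r + 1)
  rw [defectCount_two_add_two (r + 2), sum_card_compositionLists, if_pos (by omega),
    card_compositionLists, Nat.add_sub_cancel]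
  rw [show r + 2 + 1 = r + 1 + 2 by ring, show r + 2 + 2 = r + 4 by ring]
  rw [pow_succ] at h ⊢
  nlinarith

theorem defectCount_two_four : defectCount K 2 4 = 26 := by
  have := defectCount_two_add_four (K := K) 0
  simp [Finset.sum_range_succ, defectCount_zero_right, defectCount_two_one, defectCount_two_two,
    defectCount_two_three] at this
  omega

theorem defectCount_two_five : defectCount K 2 5 = 80 := by
  have := defectCount_two_add_four (K := K) 1
  simp [Finset.sum_range_succ, defectCount_zero_right, defectCount_two_one, defectCount_two_two,
    defectCount_two_three, defectCount_two_four] at this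
  omega

theorem defectCount_two_add_six (s : ℕ) :
    defectCount K 2 (s + 6) = 2 * defectCount K 2 (s + 5) + (8 * s + 66) * 2 ^ s := by
  have h1 := defectCount_two_add_four (K := K) (s + 1)
  have h2 := defectCount_two_add_four (K := K) (s + 2)
  rw [show s + 2 + 4 = s + 5 + 1 by ring, Finset.sum_range_succ] at h2
  rw [show s + 1 + 4 = s + 5 by ring] at h1
  rw [show s + 5 + 1 = s + 6 by ring, show s + 2 - 1 = s + 1 by omega, pow_succ, pow_succ] at h2
  rw [Nat.add_sub_cancel, pow_succ] at h1
  nlinarith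

theorem defectCount_two_add_five (s : ℕ) :
    defectCount K 2 (s + 5) = (2 * s ^ 2 + 31 * s + 80) * 2 ^ s := by
  induction s with
  | zero => exact defectCount_two_five
  | succ s ih =>
    rw [show s + 1 + 5 = s + 6 by ring, defectCount_two_add_six, ih]
    ring

end CountTwo

theorem seaweedCount_sub_three (K : Type*) [Field K] [CharZero K] {n : ℕ} (hn : 3 ≤ n) :
    seaweedCount K n (n - 3) = defectCount K 2 n := by
  classical
  have h : ∀ p : Composition n × Composition n, lieIndex K (seaweed K p.1 p.2) = n - 3 ↔
      seaweedDefect K p.1.blocks p.2.blocks = 2 := fun p =>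
    lieIndex_seaweed_eq_sub_three_iff hn p.1 p.2
  rw [seaweedCount, Nat.card_eq_fintype_card, Fintype.card_subtype, Finset.card_filter,
    Fintype.sum_prod_type, defectCount, compositionLists, Finset.sum_map]
  refine Finset.sum_congr rfl fun a _ => ?_
  rw [Finset.sum_map]
  refine Finset.sum_congr rfl fun b _ => ?_
  change _ = defectIndicator K 2 a.blocks b.blocks
  rw [defectIndicator]
  exact if_congr (h (a, b)) rfl rfl

/-! ### Evaluation of the sums -/

section ClosedForm

theorem sum_Icc_reflect (a b : ℕ) (f : ℕ → ℕ) :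
    ∑ m ∈ Finset.Icc a b, f m = ∑ u ∈ Finset.range (b + 1 - a), f (b - u) := by
  refine Finset.sum_nbij' (fun m => b - m) (fun u => b - u) ?_ ?_ ?_ ?_ ?_
  all_goals intro x hx
  all_goals simp only [Finset.mem_Icc, Finset.mem_range] at hx ⊢
  · omega
  · omega
  · omega
  · omega
  · rw [Nat.sub_sub_self hx.2]

theorem sum_range_mul_sub_succ (N : ℕ) (g : ℕ → ℕ) :
    ∑ u ∈ Finset.range (N + 1), g u * (N + 1 - u) =
      ∑ u ∈ Finset.range N, g u * (N - u) + ∑ u ∈ Finset.range (N + 1), g u := by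
  rw [Finset.sum_range_succ, Finset.sum_range_succ (fun u => g u), Nat.add_sub_cancel_left,
    mul_one, ← add_assoc, ← Finset.sum_add_distrib]
  congr 1
  refine Finset.sum_congr rfl fun u hu => ?_
  rw [Nat.succ_sub (Finset.mem_range.mp hu).le, Nat.mul_succ]

theorem sum_two_pow (N : ℕ) : ∑ u ∈ Finset.range N, 2 ^ u + 1 = 2 ^ N := by
  induction N with
  | zero => rfl
  | succ N ih => rw [Finset.sum_range_succ, add_right_comm, ih, pow_succ, mul_two]

theorem sum_succ_mul_two_pow (N : ℕ) :
    ∑ u ∈ Finset.range N, (u + 1) * 2 ^ u + 2 ^ N = N * 2 ^ N + 1 := by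
  induction N with
  | zero => rfl
  | succ N ih =>
    rw [Finset.sum_range_succ, pow_succ]
    linarith

theorem sum_two_pow_mul_sub (N : ℕ) :
    ∑ u ∈ Finset.range N, 2 ^ u * (N - u) + (N + 2) = 2 * 2 ^ N := by
  induction N with
  | zero => rfl
  | succ N ih =>
    have := sum_two_pow (N + 1)
    rw [sum_range_mul_sub_succ]
    rw [pow_succ] at this ⊢
    linarith

theorem sum_succ_mul_two_pow_mul_sub (N : ℕ) :
    ∑ u ∈ Finset.range N, (u + 1) * 2 ^ u * (N - u) + 4 * 2 ^ N = 2 * N * 2 ^ N + N + 4 := by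
  induction N with
  | zero => rfl
  | succ N ih =>
    have := sum_succ_mul_two_pow (N + 1)
    rw [sum_range_mul_sub_succ N fun u => (u + 1) * 2 ^ u]
    rw [pow_succ] at this ⊢
    linarith

theorem two_mul_sum_Icc_sub (u : ℕ) :
    2 * ∑ i ∈ Finset.Icc 1 (u + 1), (u + 2 - i) = (u + 1) * (u + 2) := by
  have h : ∑ i ∈ Finset.Icc 1 (u + 1), (u + 2 - i) = ∑ i ∈ Finset.range (u + 2), i := by
    rw [sum_Icc_reflect, Finset.sum_range_succ', add_zero]
    refine Finset.sum_congr rfl fun i hi => ?_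
    rw [Finset.mem_range] at hi
    omega
  rw [h, mul_comm 2, Finset.sum_range_id_mul_two]
  exact mul_comm _ _

theorem sum_triangle_mul_two_pow (N : ℕ) :
    ∑ u ∈ Finset.range N, (∑ i ∈ Finset.Icc 1 (u + 1), (u + 2 - i)) * 2 ^ u * 2 + N * 2 ^ N + 2 =
      (N ^ 2 + 2) * 2 ^ N := by
  induction N with
  | zero => rfl
  | succ N ih =>
    have h : (∑ i ∈ Finset.Icc 1 (N + 1), (N + 2 - i)) * 2 ^ N * 2 = (N + 1) * (N + 2) * 2 ^ N := by
      rw [← two_mul_sum_Icc_sub]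
      ring
    rw [Finset.sum_range_succ, h, pow_succ 2 N]
    linarith

theorem sum_triangle_mul_two_pow_mul_sub (N : ℕ) :
    ∑ u ∈ Finset.range N, (∑ i ∈ Finset.Icc 1 (u + 1), (u + 2 - i)) * 2 ^ u * (N - u) +
      (3 * N * 2 ^ N + N + 6) = (N ^ 2 + 6) * 2 ^ N := by
  induction N with
  | zero => rfl
  | succ N ih =>
    have := sum_triangle_mul_two_pow (N + 1)
    rw [← Finset.sum_mul] at this
    rw [sum_range_mul_sub_succ N fun u => (∑ i ∈ Finset.Icc 1 (u + 1), (u + 2 - i)) * 2 ^ u]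
    rw [pow_succ 2 N] at this ⊢
    linarith

theorem count_formula_eq (t : ℕ) : 4 * (∑ m ∈ Finset.Icc 4 (t + 6 - 2),
        ∑ _i ∈ Finset.Icc 1 (t + 6 - m - 1), 2 ^ (t + 6 - m - 2))
      + 8 * (∑ m ∈ Finset.Icc 4 (t + 6 - 1), 2 ^ (t + 6 - m - 1))
      + 4 * (∑ m ∈ Finset.Icc 4 (t + 6 - 3), ∑ i ∈ Finset.Icc 1 (t + 6 - m - 2),
          ∑ _j ∈ Finset.Icc 1 (t + 6 - m - i - 1), 2 ^ (t + 6 - m - 3) * (m - 3))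
      + 12 * (∑ m ∈ Finset.Icc 4 (t + 6 - 2), ∑ _i ∈ Finset.Icc 1 (t + 6 - m - 1),
          2 ^ (t + 6 - m - 2) * (m - 3))
      + 12 * (∑ m ∈ Finset.Icc 4 (t + 6 - 1), 2 ^ (t + 6 - m - 1) * (m - 3))
      + 4 * (t + 6 - 3)
      + 2 * (∑ _i ∈ Finset.Icc 1 (t + 6 - 5), 2 ^ (t + 6 - 6))
      + 2 ^ (t + 6 - 3)
      + 2 * (∑ m ∈ Finset.Icc 3 (t + 6 - 2), ∑ _i ∈ Finset.Icc 1 (t + 6 - m - 1),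
          2 ^ (t + 6 - m - 2) * (m - 2))
      + 4 * (∑ m ∈ Finset.Icc 3 (t + 6 - 1), 2 ^ (t + 6 - m - 1) * (m - 2))
      + 2 * (t + 6 - 2)
      + 4 * (∑ _i ∈ Finset.Icc 1 (t + 6 - 4), 2 ^ (t + 6 - 5))
      + 2 ^ (t + 6 - 1)
      + 4 = (2 * (t + 1) ^ 2 + 31 * (t + 1) + 80) * 2 ^ (t + 1) := by
  have e1 : ∑ m ∈ Finset.Icc 4 (t + 6 - 2), ∑ _i ∈ Finset.Icc 1 (t + 6 - m - 1),
      2 ^ (t + 6 - m - 2) = ∑ u ∈ Finset.range (t + 1), (u + 1) * 2 ^ u := by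
    rw [sum_Icc_reflect, show t + 6 - 2 + 1 - 4 = t + 1 by omega]
    refine Finset.sum_congr rfl fun u hu => ?_
    rw [Finset.mem_range] at hu
    rw [show t + 6 - (t + 6 - 2 - u) - 2 = u by omega,
      show t + 6 - (t + 6 - 2 - u) - 1 = u + 1 by omega]
    simp
  have e2 : ∑ m ∈ Finset.Icc 4 (t + 6 - 1), 2 ^ (t + 6 - m - 1) =
      ∑ u ∈ Finset.range (t + 2), 2 ^ u := by
    rw [sum_Icc_reflect, show t + 6 - 1 + 1 - 4 = t + 2 by omega]
    refine Finset.sum_congr rfl fun u hu => ?_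
    rw [Finset.mem_range] at hu
    rw [show t + 6 - (t + 6 - 1 - u) - 1 = u by omega]
  have e3 : ∑ m ∈ Finset.Icc 4 (t + 6 - 3), ∑ i ∈ Finset.Icc 1 (t + 6 - m - 2),
      ∑ _j ∈ Finset.Icc 1 (t + 6 - m - i - 1), 2 ^ (t + 6 - m - 3) * (m - 3) =
      ∑ u ∈ Finset.range t,
        (∑ i ∈ Finset.Icc 1 (u + 1), (u + 2 - i)) * 2 ^ u * (t - u) := by
    rw [sum_Icc_reflect, show t + 6 - 3 + 1 - 4 = t by omega]
    refine Finset.sum_congr rfl fun u hu => ?_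
    rw [Finset.mem_range] at hu
    rw [show t + 6 - (t + 6 - 3 - u) = u + 3 by omega, show t + 6 - 3 - u - 3 = t - u by omega,
      mul_assoc, Finset.sum_mul]
    refine Finset.sum_congr rfl fun i _ => ?_
    rw [show u + 3 - 3 = u by omega, show u + 3 - i - 1 = u + 2 - i by omega]
    simp
  have e4 : ∑ m ∈ Finset.Icc 4 (t + 6 - 2), ∑ _i ∈ Finset.Icc 1 (t + 6 - m - 1),
      2 ^ (t + 6 - m - 2) * (m - 3) =
      ∑ u ∈ Finset.range (t + 1), (u + 1) * 2 ^ u * (t + 1 - u) := by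
    rw [sum_Icc_reflect, show t + 6 - 2 + 1 - 4 = t + 1 by omega]
    refine Finset.sum_congr rfl fun u hu => ?_
    rw [Finset.mem_range] at hu
    rw [show t + 6 - (t + 6 - 2 - u) = u + 2 by omega,
      show t + 6 - 2 - u - 3 = t + 1 - u by omega]
    simp [mul_assoc]
  have e5 : ∑ m ∈ Finset.Icc 4 (t + 6 - 1), 2 ^ (t + 6 - m - 1) * (m - 3) =
      ∑ u ∈ Finset.range (t + 2), 2 ^ u * (t + 2 - u) := by
    rw [sum_Icc_reflect, show t + 6 - 1 + 1 - 4 = t + 2 by omega]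
    refine Finset.sum_congr rfl fun u hu => ?_
    rw [Finset.mem_range] at hu
    rw [show t + 6 - (t + 6 - 1 - u) - 1 = u by omega,
      show t + 6 - 1 - u - 3 = t + 2 - u by omega]
  have e9 : ∑ m ∈ Finset.Icc 3 (t + 6 - 2), ∑ _i ∈ Finset.Icc 1 (t + 6 - m - 1),
      2 ^ (t + 6 - m - 2) * (m - 2) =
      ∑ u ∈ Finset.range (t + 2), (u + 1) * 2 ^ u * (t + 2 - u) := by
    rw [sum_Icc_reflect, show t + 6 - 2 + 1 - 3 = t + 2 by omega]
    refine Finset.sum_congr rfl fun u hu => ?_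
    rw [Finset.mem_range] at hu
    rw [show t + 6 - (t + 6 - 2 - u) = u + 2 by omega,
      show t + 6 - 2 - u - 2 = t + 2 - u by omega]
    simp [mul_assoc]
  have e10 : ∑ m ∈ Finset.Icc 3 (t + 6 - 1), 2 ^ (t + 6 - m - 1) * (m - 2) =
      ∑ u ∈ Finset.range (t + 3), 2 ^ u * (t + 3 - u) := by
    rw [sum_Icc_reflect, show t + 6 - 1 + 1 - 3 = t + 3 by omega]
    refine Finset.sum_congr rfl fun u hu => ?_
    rw [Finset.mem_range] at hu
    rw [show t + 6 - (t + 6 - 1 - u) - 1 = u by omega,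
      show t + 6 - 1 - u - 2 = t + 3 - u by omega]
  rw [e1, e2, e3, e4, e5, e9, e10]
  have h1 := sum_succ_mul_two_pow (t + 1)
  have h2 := sum_two_pow (t + 2)
  have h3 := sum_triangle_mul_two_pow_mul_sub t
  have h4 := sum_succ_mul_two_pow_mul_sub (t + 1)
  have h5 := sum_two_pow_mul_sub (t + 2)
  have h9 := sum_succ_mul_two_pow_mul_sub (t + 2)
  have h10 := sum_two_pow_mul_sub (t + 3)
  simp only [Finset.sum_const, Nat.card_Icc, smul_eq_mul, Nat.add_sub_cancel,
    show t + 6 - 5 = t + 1 by omega, show t + 6 - 4 = t + 2 by omega,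
    show t + 6 - 3 = t + 3 by omega, show t + 6 - 2 = t + 4 by omega,
    show t + 6 - 1 = t + 5 by omega]
  simp only [pow_succ, pow_zero] at *
  linarith

end ClosedForm

theorem mainTheorem4 (K : Type*) [Field K] [IsAlgClosed K] [CharZero K] (n : ℕ) (hn : 4 ≤ n) :
    seaweedCount K n (n - 3) =
      4 * (∑ m ∈ Finset.Icc 4 (n - 2), ∑ _i ∈ Finset.Icc 1 (n - m - 1), 2 ^ (n - m - 2))
      + 8 * (∑ m ∈ Finset.Icc 4 (n - 1), 2 ^ (n - m - 1))
      + 4 * (∑ m ∈ Finset.Icc 4 (n - 3), ∑ i ∈ Finset.Icc 1 (n - m - 2),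
          ∑ _j ∈ Finset.Icc 1 (n - m - i - 1), 2 ^ (n - m - 3) * (m - 3))
      + 12 * (∑ m ∈ Finset.Icc 4 (n - 2), ∑ _i ∈ Finset.Icc 1 (n - m - 1),
          2 ^ (n - m - 2) * (m - 3))
      + 12 * (∑ m ∈ Finset.Icc 4 (n - 1), 2 ^ (n - m - 1) * (m - 3))
      + 4 * (n - 3)
      + 2 * (∑ _i ∈ Finset.Icc 1 (n - 5), 2 ^ (n - 6))
      + 2 ^ (n - 3)
      + 2 * (∑ m ∈ Finset.Icc 3 (n - 2), ∑ _i ∈ Finset.Icc 1 (n - m - 1),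
          2 ^ (n - m - 2) * (m - 2))
      + 4 * (∑ m ∈ Finset.Icc 3 (n - 1), 2 ^ (n - m - 1) * (m - 2))
      + 2 * (n - 2)
      + 4 * (∑ _i ∈ Finset.Icc 1 (n - 4), 2 ^ (n - 5))
      + 2 ^ (n - 1)
      + 4 := by
  rw [seaweedCount_sub_three K (by omega)]
  have hcases : n = 4 ∨ n = 5 ∨ ∃ t, n = t + 6 := by
    rcases Nat.lt_or_ge n 6 with h | h
    · omega
    · exact .inr (.inr ⟨n - 6, by omega⟩)
  rcases hcases with rfl | rfl | ⟨t, rfl⟩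
  · rw [defectCount_two_four]
    rfl
  · rw [defectCount_two_five]
    rfl
  · rw [count_formula_eq, show t + 6 = t + 1 + 5 by ring, defectCount_two_add_five]
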